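/- Let $S=\{a,b,c,d,a^{-1},b^{-1},c^{-1},d^{-1}\}$ and let $\Gamma'$ be the group with generators $a,b,c,d$ and relations $$a^{-1}ba=b^{2},\qquad b^{-2}cb^{2}=c^{2},\qquad c^{-3}dc^{3}=d^{2},\qquad d^{-4}ad^{4}=a^{2}.$$ Let $G$ be its Cayley graph: the simple undirected graph with vertex set $\Gamma'$ in which distinct $\gamma_1,\gamma_2$ are adjacent if and only if $\gamma_2=\gamma_1s$ for some $s\in S$. Let $\mathrm{Aut}(G)$ be its automorphism group. A *graph height function* on $G$ is a pair $(h,\mathcal H)$, where $h:\Gamma'\to\mathbb Z$ and $\mathcal H\le\mathrm{Aut}(G)$ is a subgroup acting quasi-transitively on $G$ (there is a finite set $W$ of vertices such that every vertex is mapped into $W$ by some element of $\mathcal H$), such that (a) $h(1)=0$; (b) $h(v)-h(w)=h(\gamma v)-h(\gamma w)$ for all vertices $v,w$ and all $\gamma\in\mathcal H$; (c) every vertex $v$ has neighbours $u,w$ with $h(u)<h(v)<h(w)$. A *group height function* on $\Gamma'$ is a function $h:\Gamma'\to\mathbb Z$, not identically zero, with $h(1)=0$, such that $h(s_1\cdots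 s_m)=\sum_{i=1}^m h(s_i)$ for all $s_1,\dots,s_m\in S$, and $\sum_{i=1}^n h(s_i)=0$ whenever $s_i\in S$ and $s_1\cdots s_n=1$. **Theorem.** The Cayley graph $G$ has no graph height function. Moreover, $\Gamma'$ has no group height function; for every vertex $v$ of $G$, the stabiliser $\{\eta\in\mathrm{Aut}(G):\eta(v)=v\}$ is trivial; and $\Gamma'$ has no proper normal subgroup of finite index. -/

import Mathlib

namespace HigmanType

/-! ### Height functions on graphs and groups -/

section Graphs

variable {V : Type*} (G : SimpleGraph V)

/-- A subgroup `H` of `Aut(G)` acts quasi-transitively on `G`: there is a finite set `W` of vertices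
such that every vertex is carried into `W` by some element of `H`. -/
def ActsQuasiTransitively (H : Subgroup (G ≃g G)) : Prop :=
  ∃ W : Set V, W.Finite ∧ ∀ v : V, ∃ α ∈ H, ∃ w ∈ W, α v = w

/-- `F` is `H`-difference-invariant. -/
def IsDifferenceInvariant (H : Subgroup (G ≃g G)) (F : V → ℤ) : Prop :=
  ∀ v w : V, ∀ γ ∈ H, F v - F w = F (γ v) - F (γ w)

/-- The pair `(h, H)` is a graph height function on the graph `G` with origin `o`. -/
structure IsGraphHeightFunction (o : V) (h : V → ℤ) (H : Subgroup (G ≃g G)) : Prop where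
  quasiTransitive : ActsQuasiTransitively G H
  map_origin : h o = 0
  differenceInvariant : IsDifferenceInvariant G H h
  exists_lt_lt : ∀ v : V, ∃ u w : V, G.Adj v u ∧ G.Adj v w ∧ h u < h v ∧ h v < h w

/-- The stabilizer of the vertex `v` in the full automorphism group of `G`. -/
def vertexStabilizer (v : V) : Subgroup (G ≃g G) where
  carrier := {η | η v = v}
  one_mem' := rfl
  mul_mem' {η θ} hη hθ := by
    change η (θ v) = v
    rw [show θ v = v from hθ, show η v = v from hη]
  inv_mem' {η} hη := by
    change η.symm v = v
    rw [RelIso.symm_apply_eq]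
    exact (show η v = v from hη).symm

end Graphs

/-- `h` is a group height function on the group `Γ` with symmetric generating set `S`. -/
structure IsGroupHeightFunction {Γ : Type*} [Group Γ] (S : Set Γ) (h : Γ → ℤ) : Prop where
  map_one : h 1 = 0
  not_identically_zero : ∃ γ : Γ, h γ ≠ 0
  map_word : ∀ l : List Γ, (∀ s ∈ l, s ∈ S) → h l.prod = (l.map h).sum
  sum_eq_zero : ∀ l : List Γ, (∀ s ∈ l, s ∈ S) → l.prod = 1 → (l.map h).sum = 0

/-! ### The group of Higman type -/

/-- The four letters `a, b, c, d`. -/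
inductive Letter : Type
  | a | b | c | d

/-- The relators of the relations
`a⁻¹ b a = b²`, `b⁻² c b² = c²`, `c⁻³ d c³ = d²`, `d⁻⁴ a d⁴ = a²`, in the free group on the
letters; the relation `u = v` has the relator `u v⁻¹`. -/
def relators : Set (FreeGroup Letter) :=
  let a := FreeGroup.of Letter.a
  let b := FreeGroup.of Letter.b
  let c := FreeGroup.of Letter.c
  let d := FreeGroup.of Letter.d
  {(a⁻¹ * b * a) * (b ^ 2)⁻¹,
   ((b ^ 2)⁻¹ * c * b ^ 2) * (c ^ 2)⁻¹,
   ((c ^ 3)⁻¹ * d * c ^ 3) * (d ^ 2)⁻¹,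
   ((d ^ 4)⁻¹ * a * d ^ 4) * (a ^ 2)⁻¹}

/-- The group `Γ'` with generators `a, b, c, d` and the above relations. -/
abbrev Group' : Type := PresentedGroup relators

/-- The symmetric generating set `{a, b, c, d, a⁻¹, b⁻¹, c⁻¹, d⁻¹}` of `Γ'`. -/
def generators : Set Group' :=
  {s | ∃ x : Letter, s = PresentedGroup.of x ∨ s = (PresentedGroup.of x)⁻¹}

/-- The (simple, undirected) Cayley graph of `Γ'`: distinct `γ₁, γ₂` are adjacent if and only if
`γ₂ = γ₁ s` for some `s` in the symmetric generating set. -/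
abbrev cayleyGraph : SimpleGraph Group' := SimpleGraph.mulCayley generators

end HigmanType

namespace HigmanType

open Monoid

/-! ### Amalgamated products -/

section Amalgam

variable {ι H : Type*} {G : ι → Type*} [∀ i, Group (G i)] [Group H] {φ : ∀ i, H →* G i}

/-! The crux is rigidity: every automorphism of the Cayley graph is a left multiplication
(`map_mul_right`, `eq_leftMul`). This gives trivial stabilisers at once, and it turns a
quasi-transitive subgroup of automorphisms into a finite-index subgroup of the group. Higman's
argument on the least prime dividing the order of a generator (`exists_prime_lt_of_dvd_orderOf`)
shows that every homomorphism to a finite group is trivial, so that subgroup is everything. A graph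
height function is then additive, hence zero, because each relation makes some generator `y`
conjugate to `y²` and so kills it in any abelian quotient. A group height function fails for the
same reason.

For rigidity, an automorphism acts on edge labels, and it preserves the pentagons traced by
cyclically reduced trivial words of length five. Such words involve only `a` and `b`, with no two
adjacent `a`s (`ne_d`, `ne_c`, `eq_b_of_eq_a`). The way pentagons meet at a vertex then separates
`b` from `a`, and both from `c` and `d`. The relator of length seven separates `c` from `d`. Finally
the relator of each piece fixes the sign of its letter `x`, and every letter is the `x` of some
piece.

Nontriviality of short words is detected in a tower of amalgams. Four Baumslag-Solitar pieces are
glued in pairs along `⟨b⟩` and along `⟨d⟩`; the two halves are glued along the free group on `a` and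
`c`. Normal forms reduce a word to short syllables, and affine actions modulo 127 show that these
avoid the amalgamated subgroup. The prime 127 works because 2 has order 7 there, so 1/2 has `k`-th
roots among the powers of 2 for `k = 1, 2, 3, 4`. The only syllables missed are conjugates of powers
of `a` by `d`, which need a separate argument resting on the irrationality of the fourth root of 2.
-/

theorem of_mem_range_base_iff (hφ : ∀ i, Function.Injective (φ i)) {i : ι} {g : G i} :
    PushoutI.of (φ := φ) i g ∈ (PushoutI.base φ).range ↔ g ∈ (φ i).range := by
  constructor
  · rintro ⟨h, hh⟩
    rw [← PushoutI.of_apply_eq_base φ i] at hh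
    exact ⟨h, PushoutI.of_injective hφ i hh⟩
  · rintro ⟨h, rfl⟩
    exact ⟨h, (PushoutI.of_apply_eq_base φ i h).symm⟩

theorem alternating_four_ne_one (hφ : ∀ i, Function.Injective (φ i)) {i j : ι} (hij : i ≠ j)
    {p q : G i} {r s : G j} (hp : p ∉ (φ i).range) (hq : q ∉ (φ i).range)
    (hr : r ∉ (φ j).range) (hs : s ∉ (φ j).range) :
    PushoutI.of (φ := φ) i p * PushoutI.of j r * PushoutI.of i q * PushoutI.of j s ≠ 1 := by
  intro h
  have ne {k : ι} {g : G k} (hg : g ∉ (φ k).range) : g ≠ 1 := fun h => hg (h ▸ one_mem _)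
  let w : CoprodI.Word G :=
    ⟨[⟨i, p⟩, ⟨j, r⟩, ⟨i, q⟩, ⟨j, s⟩], by simp [ne hp, ne hq, ne hr, ne hs], by
      simp [hij, hij.symm]⟩
  have hw : PushoutI.Reduced φ w := by
    simp only [w, PushoutI.Reduced, List.mem_cons, forall_eq_or_imp]
    exact ⟨hp, hr, hq, hs, by simp⟩
  have := hw.eq_empty_of_mem_range hφ (by
    simp only [w, CoprodI.Word.prod, List.map_cons, List.prod_cons, List.prod_nil, List.map_nil,
      map_mul, PushoutI.ofCoprodI_of, mul_one, ← mul_assoc, h]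
    exact one_mem _)
  simp [w, CoprodI.Word.empty] at this

/-- The homomorphism from a free product to an amalgamated product given by homomorphisms of the
factors. -/
def coprodToPushout {K : ι → Type*} [∀ i, Group (K i)] (φ : ∀ i, H →* G i)
    (f : ∀ i, K i →* G i) : CoprodI K →* PushoutI φ :=
  CoprodI.lift fun i => (PushoutI.of i).comp (f i)

variable {K : ι → Type*} [∀ i, Group (K i)] {f : ∀ i, K i →* G i}

/-- Each syllable of a reduced word in the free product is sent outside the amalgamated subgroup, so
the image word is still reduced. By the normal form theorem it can lie in the base only if it is
empty. -/
theorem eq_one_of_coprodToPushout_mem_range (hφ : ∀ i, Function.Injective (φ i))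
    (hf : ∀ i x, f i x ∈ (φ i).range → x = 1) {x : CoprodI K}
    (hx : coprodToPushout φ f x ∈ (PushoutI.base φ).range) : x = 1 := by
  classical
  obtain ⟨w, rfl⟩ := CoprodI.Word.equiv.symm.surjective x
  change coprodToPushout φ f w.prod ∈ _ at hx
  change w.prod = 1
  let w' : CoprodI.Word G :=
    ⟨w.toList.map fun l => ⟨l.1, f l.1 l.2⟩, by
      simp only [List.mem_map, forall_exists_index, and_imp]
      rintro _ l hl rfl h
      exact w.ne_one l hl (hf _ _ (by
        change f l.1 l.2 = 1 at h
        rw [h]; exact one_mem _)), by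
      rw [List.isChain_map]; exact w.chain_ne⟩
  have hw' : PushoutI.Reduced φ w' := by
    simp only [w', PushoutI.Reduced, List.mem_map, forall_exists_index, and_imp]
    rintro _ l hl rfl h
    exact w.ne_one l hl (hf _ _ h)
  have hprod : PushoutI.ofCoprodI w'.prod = coprodToPushout φ f w.prod := by
    simp only [CoprodI.Word.prod, w', map_list_prod, List.map_map]
    refine congrArg List.prod (List.map_congr_left fun l _ => ?_)
    simp [coprodToPushout]
  have := hw'.eq_empty_of_mem_range hφ (hprod ▸ hx)
  have : w.toList = [] := by
    have h := congrArg CoprodI.Word.toList this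
    simpa [w', CoprodI.Word.empty] using h
  simp [CoprodI.Word.prod, this]

theorem coprodToPushout_injective (hφ : ∀ i, Function.Injective (φ i))
    (hf : ∀ i x, f i x ∈ (φ i).range → x = 1) :
    Function.Injective (coprodToPushout φ f) :=
  (injective_iff_map_eq_one _).2 fun _ hx =>
    eq_one_of_coprodToPushout_mem_range hφ hf (hx ▸ one_mem _)

end Amalgam

/-! ### Baumslag-Solitar type groups -/

/-- The group `⟨x, y | x⁻ᵏ y xᵏ = y²⟩`, with `x` and `y` indexed by `false` and `true`. -/
abbrev BS (k : ℕ) : Type :=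
  PresentedGroup {((FreeGroup.of false ^ k)⁻¹ * FreeGroup.of true * FreeGroup.of false ^ k) *
    (FreeGroup.of true ^ 2)⁻¹}

namespace BS

/-- The generator `x`. -/
def x (k : ℕ) : BS k := PresentedGroup.of false

/-- The generator `y`. -/
def y (k : ℕ) : BS k := PresentedGroup.of true

theorem rel (k : ℕ) : (x k ^ k)⁻¹ * y k * x k ^ k = y k ^ 2 := by
  have := PresentedGroup.mk_eq_mk_of_mul_inv_mem
    (rels := {((FreeGroup.of false ^ k)⁻¹ * FreeGroup.of true * FreeGroup.of false ^ k) *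
    (FreeGroup.of true ^ 2)⁻¹}) (Set.mem_singleton _)
  simp only [map_mul, map_inv, map_pow] at this
  exact this

variable {k : ℕ} {G : Type*} [Group G]

/-- The homomorphism given by elements that satisfy the relation. -/
def lift (u v : G) (h : (u ^ k)⁻¹ * v * u ^ k = v ^ 2) : BS k →* G :=
  PresentedGroup.toGroup (f := fun i => cond i v u) (by
    rintro r rfl
    simp only [map_mul, map_inv, map_pow, FreeGroup.lift_apply_of, cond_true, cond_false, h]
    exact mul_inv_cancel _)

@[simp] theorem lift_x (u v : G) (h : (u ^ k)⁻¹ * v * u ^ k = v ^ 2) : lift u v h (x k) = u :=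
  PresentedGroup.toGroup.of _

@[simp] theorem lift_y (u v : G) (h : (u ^ k)⁻¹ * v * u ^ k = v ^ 2) : lift u v h (y k) = v :=
  PresentedGroup.toGroup.of _

/-- The exponent sum of `x`. -/
def expX (k : ℕ) : BS k →* Multiplicative ℤ := lift (Multiplicative.ofAdd 1) 1 (by simp)

/-- The positive real `k`-th root of `1 / 2`. -/
noncomputable def root (k : ℕ) : ℝ := (1 / 2 : ℝ) ^ ((k : ℝ)⁻¹)

theorem root_pos : 0 < root k := by unfold root; positivity

theorem root_pow (hk : k ≠ 0) : root k ^ k = 1 / 2 := Real.rpow_inv_natCast_pow (by norm_num) hk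

/-- The affine action on the real line, in which `x` is the multiplication by `root k` and `y` is
the translation by `1`. -/
noncomputable def affine (hk : k ≠ 0) : BS k →* Equiv.Perm ℝ :=
  lift (MulAction.toPermHom ℝˣ ℝ (Units.mk0 (root k) root_pos.ne')) (Equiv.addRight 1) (by
    have h : Units.mk0 (root k) root_pos.ne' ^ k = Units.mk0 (1 / 2 : ℝ) (by norm_num) := by
      ext; simp [root_pow hk]
    rw [← map_pow, h, mul_assoc, inv_mul_eq_iff_eq_mul]
    ext t
    simp [pow_two, Units.smul_def]
    ring)

@[simp] theorem affine_x_zpow (hk : k ≠ 0) (n : ℤ) (t : ℝ) :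
    affine hk (x k ^ n) t = root k ^ n * t := by
  rw [affine, map_zpow, lift_x, ← map_zpow]
  simp [Units.smul_def]

@[simp] theorem affine_y_zpow (hk : k ≠ 0) (n : ℤ) (t : ℝ) : affine hk (y k ^ n) t = t + n := by
  rw [affine, map_zpow, lift_y]
  simp

/-- On the real line powers of `x` fix 0 while nonzero powers of `y` move it, and `x` scales by a
factor other than 1. Hence both generators have infinite order and their cyclic groups meet
trivially, which is what the amalgamations require. -/
theorem eq_zero_of_zpow_eq_zpow (hk : k ≠ 0) {m n : ℤ} (h : x k ^ m = y k ^ n) :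
    m = 0 ∧ n = 0 := by
  have h0 := congrArg (fun g => affine hk g 0) h
  have h1 := congrArg (fun g => affine hk g 1) h
  simp only [affine_x_zpow, affine_y_zpow, mul_zero, zero_add] at h0 h1
  have hn : n = 0 := by exact_mod_cast h0.symm
  refine ⟨?_, hn⟩
  subst hn
  have hne : root k ≠ 1 := fun h => by have := root_pow hk; rw [h] at this; norm_num at this
  simp only [mul_one, Int.cast_zero, add_zero] at h1
  by_contra hm
  exact hm ((zpow_eq_one_iff_right₀ root_pos.le hne).1 h1)

/-- Evaluated at 0, an equality would make `i` times a fourth root of 2, or of 1/2, an integer. -/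
theorem conj_zpow_ne_zpow {e : ℤ} (he : e = 1 ∨ e = -1) {i : ℤ} (hi : i ≠ 0) (hi' : |i| ≤ 2)
    (m : ℤ) : x 4 ^ e * y 4 ^ i * x 4 ^ (-e) ≠ y 4 ^ m := by
  intro h
  have h0 := congrArg (fun g => affine (k := 4) (by norm_num) g 0) h
  simp only [map_mul, Equiv.Perm.mul_apply, affine_x_zpow, affine_y_zpow, mul_zero, zero_add] at h0
  have hr := root_pow (k := 4) (by norm_num)
  have hr0 : root 4 ≠ 0 := root_pos.ne'
  obtain ⟨h1, h2⟩ := abs_le.1 hi'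
  have key : i ^ 4 = 2 * m ^ 4 ∨ m ^ 4 = 2 * i ^ 4 := by
    rcases he with rfl | rfl
    · left
      have : (i : ℝ) ^ 4 = 2 * m ^ 4 := by
        rw [← h0, zpow_one, mul_pow, hr]; ring
      exact_mod_cast this
    · right
      have h3 : (i : ℝ) = root 4 * m := by
        rw [← h0]; field_simp
      have : (m : ℝ) ^ 4 = 2 * i ^ 4 := by
        rw [h3, mul_pow, hr]; ring
      exact_mod_cast this
  -- Since `|i| ≤ 2`, either equation gives at most `2 * 2 ^ 4`, which is below `3 ^ 4`; only
  -- finitely many pairs remain.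
  have hm4 : m ^ 4 ≤ 32 := by
    rcases key with key | key <;> interval_cases i <;> simp at key hi <;> omega
  have hm : -3 < m ∧ m < 3 := by
    constructor <;> by_contra! hm <;>
      nlinarith [show 9 ≤ m ^ 2 by nlinarith, show m ^ 4 = m ^ 2 * m ^ 2 by ring]
  obtain ⟨h3, h4⟩ := hm
  interval_cases i <;> interval_cases m <;> omega

end BS

/-! ### Cyclic words of length five in an amalgam -/

section FiveLetters

variable {L G : Type*} [Group G] {X Y F : Subgroup G} {val : L → G} {R : L → L → Prop}
  {isX isY isF : L → Prop}

/-- Read cyclically, the word splits into alternating `X`- and `Y`-syllables, with letters of `F`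
absorbed by a neighbour. Their number is even, so five letters leave four, two or none. With four,
each `X`-syllable can be taken with at most two letters, and `halt` applies. With two, only the
`Y`-syllable has to avoid `F`. With no letter of type `X`, either a letter of `F` is split off from
the other four, or `five` applies. -/
theorem five_letters_ne_one (hFX : F ≤ X) (hFY : F ≤ Y) (hXY : X ⊓ Y ≤ F)
    (halt : ∀ p ∈ X, ∀ q ∈ X, ∀ r ∈ Y, ∀ s ∈ Y, p ∉ F → q ∉ F → r ∉ F → s ∉ F →
      p * r * q * s ≠ 1)
    (valX : ∀ s, isX s → val s ∈ X) (valY : ∀ s, isY s → val s ∈ Y)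
    (valF : ∀ s, isF s → val s ∈ F)
    (chunkY : ∀ l : List L, l.length ≤ 4 → l.IsChain R → (∀ s ∈ l, isY s ∨ isF s) →
      (∃ s ∈ l, isY s) → (l.map val).prod ∉ F)
    (chunkX : ∀ l : List L, l.length ≤ 2 → l.IsChain R → (∀ s ∈ l, isX s ∨ isF s) →
      (∃ s ∈ l, isX s) → (l.map val).prod ∉ F)
    (five : ∀ s t u v w, isY s → isY t → isY u → isY v → isY w → [s, t, u, v, w].IsChain R →
      val s * val t * val u * val v * val w ≠ 1)
    {s t u v w : L} (hs : isY s) (ht : isX t ∨ isY t ∨ isF t) (hu : isX u ∨ isY u ∨ isF u)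
    (hv : isX v ∨ isY v ∨ isF v) (hw : isX w ∨ isY w ∨ isF w)
    (hst : R s t) (htu : R t u) (huv : R u v) (hvw : R v w) (hws : R w s) :
    val s * val t * val u * val v * val w ≠ 1 := by
  intro h
  have rot {x y : G} (h : x * y = 1) : y * x = 1 := by
    rw [eq_inv_of_mul_eq_one_left h, mul_inv_cancel]
  have r0 : val s * (val t * (val u * (val v * val w))) = 1 := by simpa only [mul_assoc] using h
  have r1 : val t * (val u * (val v * (val w * val s))) = 1 := by simpa only [mul_assoc] using rot r0
  have r2 : val u * (val v * (val w * (val s * val t))) = 1 := by simpa only [mul_assoc] using rot r1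
  have r3 : val v * (val w * (val s * (val t * val u))) = 1 := by simpa only [mul_assoc] using rot r2
  have r4 : val w * (val s * (val t * (val u * val v))) = 1 := by simpa only [mul_assoc] using rot r3
  have inX {s : L} (h : isX s ∨ isF s) : val s ∈ X := h.elim (valX s) fun h => hFX (valF s h)
  have inY {s : L} (h : isY s ∨ isF s) : val s ∈ Y := h.elim (valY s) fun h => hFY (valF s h)
  -- Two syllables: each factor is the inverse of the other, so the `Y`-factor would lie in `X ⊓ Y ≤
  -- F`.
  have two {p q : G} (hp : p ∈ X) (hq : q ∈ Y) (hqF : q ∉ F) : p * q ≠ 1 := fun h =>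
    hqF (hXY ⟨by rw [eq_inv_of_mul_eq_one_right h]; exact X.inv_mem hp, hq⟩)
  have last {p q : G} (hq : q ∈ F) (hp : p ∉ F) : p * q ≠ 1 := fun h =>
    hp (by rw [eq_inv_of_mul_eq_one_left h]; exact F.inv_mem hq)
  have y1 {s : L} (hs : isY s) : val s ∉ F := by
    simpa using chunkY [s] (by simp) (by simp) (by simp [hs]) (by simp [hs])
  have x1 {s : L} (hs : isX s) : val s ∉ F := by
    simpa using chunkX [s] (by simp) (by simp) (by simp [hs]) (by simp [hs])
  have y2 {s t : L} (hst : R s t) (hs : isY s ∨ isF s) (ht : isY t ∨ isF t)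
      (h : isY s ∨ isY t) : val s * val t ∉ F := by
    simpa using chunkY [s, t] (by simp) (by simpa) (by simp [hs, ht]) (by simpa)
  have x2 {s t : L} (hst : R s t) (hs : isX s ∨ isF s) (ht : isX t ∨ isF t)
      (h : isX s ∨ isX t) : val s * val t ∉ F := by
    simpa using chunkX [s, t] (by simp) (by simpa) (by simp [hs, ht]) (by simpa)
  have y3 {s t u : L} (hst : R s t) (htu : R t u) (hs : isY s ∨ isF s) (ht : isY t ∨ isF t)
      (hu : isY u ∨ isF u) (h : isY s ∨ isY t ∨ isY u) : val s * (val t * val u) ∉ F := by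
    simpa using chunkY [s, t, u] (by simp) (by simp [hst, htu]) (by simp [hs, ht, hu]) (by simpa)
  have y4 {s t u v : L} (hst : R s t) (htu : R t u) (huv : R u v) (hs : isY s ∨ isF s)
      (ht : isY t ∨ isF t) (hu : isY u ∨ isF u) (hv : isY v ∨ isF v)
      (h : isY s ∨ isY t ∨ isY u ∨ isY v) : val s * (val t * (val u * val v)) ∉ F := by
    simpa using chunkY [s, t, u, v] (by simp) (by simp [hst, htu, huv])
      (by simp [hs, ht, hu, hv]) (by simpa)
  have hs' : isY s ∨ isF s := .inl hs
  have mX {p q : G} (hp : p ∈ X) (hq : q ∈ X) : p * q ∈ X := mul_mem hp hq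
  have mY {p q : G} (hp : p ∈ Y) (hq : q ∈ Y) : p * q ∈ Y := mul_mem hp hq
  rcases ht with ht | ht
  · -- `t` is of type `X`
    have ht' : isX t ∨ isF t := .inl ht
    rcases hw with hw | hw
    · have hw' : isX w ∨ isF w := .inl hw
      -- With `t` and `w` in `X` and `s` in `Y`, a further `Y`-letter among `u`, `v` produces four
      -- syllables.
      have tail : isY u ∨ isY v → False := by
        rintro (hu | hv)
        · rcases hv with hv | hv
          · exact halt _ (inX ht') _ (mX (inX (.inl hv)) (inX hw')) _ (valY u hu) _ (valY s hs)
              (x1 ht) (x2 hvw (.inl hv) hw' (.inl hv)) (y1 hu) (y1 hs) (by simpa only [mul_assoc] using r1)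
          · exact halt _ (inX ht') _ (inX hw') _ (mY (valY u hu) (inY hv)) _ (valY s hs)
              (x1 ht) (x1 hw) (y2 huv (.inl hu) hv (.inl hu)) (y1 hs) (by simpa only [mul_assoc] using r1)
        · rcases hu with hu | hu
          · exact halt _ (mX (inX ht') (inX (.inl hu))) _ (inX hw') _ (valY v hv) _ (valY s hs)
              (x2 htu ht' (.inl hu) (.inl ht)) (x1 hw) (y1 hv) (y1 hs) (by simpa only [mul_assoc] using r1)
          · exact halt _ (inX ht') _ (inX hw') _ (mY (inY hu) (valY v hv)) _ (valY s hs)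
              (x1 ht) (x1 hw) (y2 huv hu (.inl hv) (.inr hv)) (y1 hs) (by simpa only [mul_assoc] using r1)
      have hu' : isX u ∨ isF u := hu.imp_right (·.resolve_left fun h => tail (.inl h))
      have hv' : isX v ∨ isF v := hv.imp_right (·.resolve_left fun h => tail (.inr h))
      exact two (mX (inX ht') (mX (inX hu') (mX (inX hv') (inX hw')))) (inY hs') (y1 hs)
        (by simpa only [mul_assoc] using r1)
    rcases hv with hv | hv
    · have hv' : isX v ∨ isF v := .inl hv
      rcases (or_left_comm.1 hu : isY u ∨ (isX u ∨ isF u)) with hu | hu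
      · exact halt _ (inX ht') _ (inX hv') _ (valY u hu) _ (mY (inY hw) (valY s hs)) (x1 ht)
          (x1 hv) (y1 hu) (y2 hws hw hs' (.inr hs)) (by simpa only [mul_assoc] using r1)
      · exact two (mX (inX ht') (mX (inX hu) (inX hv'))) (mY (inY hw) (inY hs'))
          (y2 hws hw hs' (.inr hs)) (by simpa only [mul_assoc] using r1)
    rcases hu with hu | hu
    · exact two (mX (inX ht') (inX (.inl hu))) (mY (inY hv) (mY (inY hw) (inY hs')))
        (y3 hvw hws hv hw hs' (.inr (.inr hs))) (by simpa only [mul_assoc] using r1)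
    · exact two (inX ht') (mY (inY hu) (mY (inY hv) (mY (inY hw) (inY hs'))))
        (y4 huv hvw hws hu hv hw hs' (.inr (.inr (.inr hs)))) (by simpa only [mul_assoc] using r1)
  rcases hu with hu | hu
  · have hu' : isX u ∨ isF u := .inl hu
    rcases hw with hw | hw
    · have hw' : isX w ∨ isF w := .inl hw
      rcases (or_left_comm.1 hv : isY v ∨ (isX v ∨ isF v)) with hv | hv
      · exact halt _ (inX hu') _ (inX hw') _ (valY v hv) _ (mY (valY s hs) (inY ht)) (x1 hu)
          (x1 hw) (y1 hv) (y2 hst hs' ht (.inl hs)) (by simpa only [mul_assoc] using r2)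
      · exact two (mX (inX hu') (mX (inX hv) (inX hw'))) (mY (inY hs') (inY ht))
          (y2 hst hs' ht (.inl hs)) (by simpa only [mul_assoc] using r2)
    rcases hv with hv | hv
    · exact two (mX (inX hu') (inX (.inl hv))) (mY (inY hw) (mY (inY hs') (inY ht)))
        (y3 hws hst hw hs' ht (.inr (.inl hs))) (by simpa only [mul_assoc] using r2)
    · exact two (inX hu') (mY (inY hv) (mY (inY hw) (mY (inY hs') (inY ht))))
        (y4 hvw hws hst hv hw hs' ht (.inr (.inr (.inl hs)))) (by simpa only [mul_assoc] using r2)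
  rcases hv with hv | hv
  · rcases hw with hw | hw
    · exact two (mX (inX (.inl hv)) (inX (.inl hw))) (mY (inY hs') (mY (inY ht) (inY hu)))
        (y3 hst htu hs' ht hu (.inl hs)) (by simpa only [mul_assoc] using r3)
    · exact two (inX (.inl hv)) (mY (inY hw) (mY (inY hs') (mY (inY ht) (inY hu))))
        (y4 hws hst htu hw hs' ht hu (.inr (.inl hs))) (by simpa only [mul_assoc] using r3)
  rcases hw with hw | hw
  · exact two (inX (.inl hw)) (mY (inY hs') (mY (inY ht) (mY (inY hu) (inY hv))))
      (y4 hst htu huv hs' ht hu hv (.inl hs)) (by simpa only [mul_assoc] using r4)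
  -- no letter is of type `X`
  rcases hw with hw' | hw'
  · rcases hv with hv' | hv'
    · rcases hu with hu' | hu'
      · rcases ht with ht' | ht'
        · exact five s t u v w hs ht' hu' hv' hw' (by simp [*]) h
        · exact last (valF t ht') (y4 huv hvw hws (.inl hu') (.inl hv') (.inl hw') hs' (.inr (.inr (.inr hs))))
            (by simpa only [mul_assoc] using r2)
      · exact last (valF u hu') (y4 hvw hws hst (.inl hv') (.inl hw') hs' ht (.inr (.inr (.inl hs))))
          (by simpa only [mul_assoc] using r3)
    · exact last (valF v hv') (y4 hws hst htu (.inl hw') hs' ht hu (.inr (.inl hs)))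
        (by simpa only [mul_assoc] using r4)
  · exact last (valF w hw') (y4 hst htu huv hs' ht hu hv (.inl hs)) (by simpa only [mul_assoc] using r0)

end FiveLetters

/-! ### A tower of amalgamated products -/

/-- The exponents of the four pieces `⟨a, b⟩`, `⟨b, c⟩`, `⟨c, d⟩`, `⟨d, a⟩` of the tower. -/
def exponent : Bool → Bool → ℕ
  | false, false => 1
  | false, true => 2
  | true, true => 3
  | true, false => 4

theorem exponent_ne_zero (i j : Bool) : exponent i j ≠ 0 := by cases i <;> cases j <;> decide

/-- The pieces of the tower. -/
abbrev Piece (i j : Bool) : Type := BS (exponent i j)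

/-- The generator of a piece that is shared with the other piece of the same half: it is `b` for
`i = false` and `d` for `i = true`. -/
def innerGen (i j : Bool) : Piece i j := if i = j then BS.y _ else BS.x _

/-- The generator of a piece that is shared with a piece of the other half: it is `a` for
`j = false` and `c` for `j = true`. -/
def outerGen (i j : Bool) : Piece i j := if i = j then BS.x _ else BS.y _

theorem outerGen_zpow_eq {i j : Bool} {m n : ℤ} (h : outerGen i j ^ m = innerGen i j ^ n) :
    m = 0 ∧ n = 0 := by
  unfold outerGen innerGen at h
  split_ifs at h
  · exact BS.eq_zero_of_zpow_eq_zpow (exponent_ne_zero i j) h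
  · exact (BS.eq_zero_of_zpow_eq_zpow (exponent_ne_zero i j) h.symm).symm

/-- The inclusion of the cyclic group generated by `innerGen`. -/
def inner (i j : Bool) : Multiplicative ℤ →* Piece i j := zpowersHom _ (innerGen i j)

/-- The inclusion of the cyclic group generated by `outerGen`. -/
def outer (i j : Bool) : Multiplicative ℤ →* Piece i j := zpowersHom _ (outerGen i j)

theorem inner_apply (i j : Bool) (n : Multiplicative ℤ) :
    inner i j n = innerGen i j ^ n.toAdd := rfl

theorem outer_apply (i j : Bool) (n : Multiplicative ℤ) :
    outer i j n = outerGen i j ^ n.toAdd := rfl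

theorem inner_injective (i j : Bool) : Function.Injective (inner i j) :=
  (injective_iff_map_eq_one _).2 fun n hn => by
    have : outerGen i j ^ (0 : ℤ) = innerGen i j ^ n.toAdd := by
      rw [zpow_zero, ← hn, inner_apply]
    exact (outerGen_zpow_eq this).2

theorem eq_one_of_outer_mem_range (i j : Bool) (n : Multiplicative ℤ)
    (h : outer i j n ∈ (inner i j).range) : n = 1 := by
  obtain ⟨m, hm⟩ := h
  rw [inner_apply, outer_apply] at hm
  exact (outerGen_zpow_eq hm.symm).1

/-- The two halves of the tower, generated by `a, b, c` and by `c, d, a`. -/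
abbrev Half (i : Bool) : Type := PushoutI (inner i)

/-- The free group on `a` and `c`. -/
abbrev Core : Type := CoprodI fun _ : Bool => Multiplicative ℤ

/-- The inclusion of the core in the halves. -/
def core (i : Bool) : Core →* Half i := coprodToPushout (inner i) (outer i)

theorem core_injective (i : Bool) : Function.Injective (core i) :=
  coprodToPushout_injective (inner_injective i) (eq_one_of_outer_mem_range i)

/-- The whole tower. -/
abbrev Tower : Type := PushoutI core

/-! ### Signed letters -/

instance : DecidableEq Letter := fun x y => by
  cases x <;> cases y <;> first | exact isTrue rfl | exact isFalse fun h => by cases h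

instance : Fintype Letter := ⟨{.a, .b, .c, .d}, fun x => by cases x <;> decide⟩

/-- A letter or the inverse of a letter. -/
abbrev Signed : Type := Letter × Bool

/-- The inverse of a signed letter. -/
def Signed.inv (s : Signed) : Signed := (s.1, !s.2)

/-- The value of a signed letter in a group with four marked elements. -/
def Signed.val {G : Type*} [Group G] (f : Letter → G) (s : Signed) : G :=
  cond s.2 (f s.1) (f s.1)⁻¹

/-- `s t` is a reduced word. -/
abbrev Reduced (s t : Signed) : Prop := t ≠ s.inv

theorem Signed.val_inv {G : Type*} [Group G] (f : Letter → G) (s : Signed) :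
    s.inv.val f = (s.val f)⁻¹ := by
  obtain ⟨l, _ | _⟩ := s <;> simp [Signed.inv, Signed.val]

theorem Signed.map_val {G H : Type*} [Group G] [Group H] (g : G →* H) (f : Letter → G)
    (s : Signed) : g (s.val f) = s.val (g ∘ f) := by
  obtain ⟨l, _ | _⟩ := s <;> simp [Signed.val]

theorem Signed.map_prod_val {G H : Type*} [Group G] [Group H] (g : G →* H) (f : Letter → G)
    (l : List Signed) : g (l.map (Signed.val f)).prod = (l.map (Signed.val (g ∘ f))).prod := by
  rw [map_list_prod, List.map_map]
  exact congrArg List.prod (List.map_congr_left fun s _ => Signed.map_val g f s)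

/-! ### Affine actions modulo `127` -/

/-- The translation by `1` modulo `127`. -/
def shift : Equiv.Perm (ZMod 127) := Equiv.addRight 1

/-- The multiplication by `2 ^ n` modulo `127`. -/
def scale (n : ℕ) : Equiv.Perm (ZMod 127) where
  toFun t := 2 ^ n * t
  invFun t := 64 ^ n * t
  left_inv t := by
    beta_reduce
    rw [← mul_assoc, ← mul_pow, show (64 * 2 : ZMod 127) = 1 by decide, one_pow, one_mul]
  right_inv t := by
    beta_reduce
    rw [← mul_assoc, ← mul_pow, show (2 * 64 : ZMod 127) = 1 by decide, one_pow, one_mul]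

theorem scale_pow (n k : ℕ) : scale n ^ k = scale (n * k) := by
  induction k with
  | zero => ext1 t; simp [scale]
  | succ k ih =>
    rw [pow_succ, ih]
    ext1 t
    simp [scale, Nat.mul_succ, pow_add, mul_assoc]

theorem scale_rel {n k : ℕ} (h : (2 : ZMod 127) ^ (n * k) = 64) :
    (scale n ^ k)⁻¹ * shift * scale n ^ k = shift ^ 2 := by
  rw [scale_pow, mul_assoc, inv_mul_eq_iff_eq_mul]
  ext1 t
  simp only [scale, shift, Equiv.Perm.mul_apply, Equiv.coe_fn_mk, h, pow_two,
    Equiv.coe_addRight]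
  have : (64 * 2 : ZMod 127) = 1 := by decide
  linear_combination -this

/-- The exponent of the power of `2` that is a root of `1 / 2` modulo `127`. -/
def rootExponent (i j : Bool) : ℕ :=
  match i, j with
  | false, false => 6
  | false, true => 3
  | true, true => 2
  | true, false => 5

/-- The affine action of a piece modulo `127`. -/
def pieceAffine (i j : Bool) : Piece i j →* Equiv.Perm (ZMod 127) :=
  BS.lift (scale (rootExponent i j)) shift (scale_rel (by cases i <;> cases j <;> decide))

/-- The action of a half modulo `127` in which one of the outer generators is trivial. -/
def halfAffine (i : Bool) : Half i →* Equiv.Perm (ZMod 127) :=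
  PushoutI.lift
    (fun j => if h : i = j then pieceAffine i j else BS.lift shift 1 (by simp))
    (zpowersHom _ shift) (fun j => by
      ext
      by_cases h : i = j <;> simp [h, inner, innerGen, pieceAffine])

theorem halfAffine_inner (i j : Bool) : halfAffine i (PushoutI.of j (innerGen i j)) = shift := by
  by_cases h : i = j <;> simp [halfAffine, h, innerGen, pieceAffine]

theorem halfAffine_outer (i j : Bool) : halfAffine i (PushoutI.of j (outerGen i j)) =
    if i = j then scale (rootExponent i i) else 1 := by
  by_cases h : i = j
  · subst h; simp [halfAffine, outerGen, pieceAffine]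
  · simp [halfAffine, h, outerGen]

/-- One outer generator acts by scaling and the other trivially, so all of the core fixes 0. Moving
0 is therefore a certificate of not lying in the core. -/
theorem halfAffine_core_apply_zero (i : Bool) (x : Core) : halfAffine i (core i x) 0 = 0 := by
  induction x using CoprodI.induction_on with
  | one => simp
  | of j n =>
    have h : halfAffine i (PushoutI.of j (outerGen i j)) 0 = 0 := by
      rw [halfAffine_outer]; split_ifs <;> simp [scale]
    have : core i (CoprodI.of (i := j) n) = PushoutI.of j (outerGen i j) ^ n.toAdd := by
      simp [core, coprodToPushout, outer_apply]
    rw [this, map_zpow]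
    exact Equiv.Perm.zpow_apply_eq_self_of_apply_eq_self h _
  | mul x y hx hy => simp [hx, hy]

/-! ### Words in the halves -/

/-- The generators in a half; both `b` and `d` are sent to the inner generator. -/
def halfMark (i : Bool) : Letter → Half i
  | .a => PushoutI.of false (outerGen i false)
  | .b => PushoutI.of false (innerGen i false)
  | .c => PushoutI.of true (outerGen i true)
  | .d => PushoutI.of false (innerGen i false)

theorem of_innerGen (i j : Bool) :
    PushoutI.of (φ := inner i) j (innerGen i j) = PushoutI.base (inner i) (.ofAdd 1) := by
  rw [← PushoutI.of_apply_eq_base (inner i) j, inner_apply]; simp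

theorem core_of (i j : Bool) :
    core i (CoprodI.of (i := j) (.ofAdd 1)) = PushoutI.of j (outerGen i j) := by
  simp [core, coprodToPushout, outer_apply]

/-- The action modulo `127` of the generators of a half. -/
def halfAct : Bool → Letter → Equiv.Perm (ZMod 127)
  | false, .a => scale 6
  | false, .c => 1
  | true, .a => 1
  | true, .c => scale 2
  | _, .b => shift
  | _, .d => shift

theorem halfAffine_comp_halfMark (i : Bool) : halfAffine i ∘ halfMark i = halfAct i := by
  funext l
  cases l <;> simp only [Function.comp_apply, halfMark, halfAffine_inner, halfAffine_outer] <;>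
    cases i <;> rfl

theorem prod_notMem_core_of_apply_zero_ne (i : Bool) (l : List Signed)
    (h : (l.map (Signed.val (halfAct i))).prod 0 ≠ 0) :
    (l.map (Signed.val (halfMark i))).prod ∉ (core i).range := by
  rintro ⟨x, hx⟩
  apply h
  rw [← halfAffine_comp_halfMark, ← Signed.map_prod_val, ← hx, halfAffine_core_apply_zero]

/-- Subgroups of the pieces of the half generated by `c, d, a` that contain the outer generators and
meet the inner cyclic groups trivially. -/
def outerSubgroup : (j : Bool) → Subgroup (Piece true j)
  | false => (BS.expX 4).ker
  | true => Subgroup.zpowers (outerGen true true)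

theorem outerGen_mem_outerSubgroup : ∀ j, outerGen true j ∈ outerSubgroup j
  | false => by
    change BS.expX 4 (BS.y 4) = 1
    simp [BS.expX]
  | true => Subgroup.mem_zpowers _

theorem eq_one_of_mem_outerSubgroup : ∀ (j : Bool) (x : outerSubgroup j),
    (outerSubgroup j).subtype x ∈ (inner true j).range → x = 1
  | false, ⟨x, hx⟩, ⟨n, hn⟩ => by
    change BS.expX 4 x = 1 at hx
    change BS.x 4 ^ n.toAdd = x at hn
    have h : n.toAdd = 0 := by
      rw [← hn] at hx
      simpa [BS.expX, ← ofAdd_zsmul] using hx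
    rw [h, zpow_zero] at hn
    exact Subtype.ext hn.symm
  | true, ⟨x, ⟨m, hm⟩⟩, ⟨n, hn⟩ => by
    change outerGen true true ^ m = x at hm
    change innerGen true true ^ n.toAdd = x at hn
    have h := (outerGen_zpow_eq (hm.trans hn.symm)).1
    rw [h, zpow_zero] at hm
    exact Subtype.ext hm.symm

/-- The core as a subgroup of the free product of the groups `outerSubgroup`. -/
def coreToOuter : Core →* CoprodI fun j => outerSubgroup j :=
  CoprodI.lift fun j => CoprodI.of.comp
    (zpowersHom (outerSubgroup j) ⟨outerGen true j, outerGen_mem_outerSubgroup j⟩)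

/-- The retraction of the free product onto its first factor. -/
def outerRetract : (CoprodI fun j => outerSubgroup j) →* outerSubgroup false :=
  CoprodI.lift fun
    | false => MonoidHom.id _
    | true => 1

theorem coprodToPushout_comp_coreToOuter :
    (coprodToPushout (inner true) fun j => (outerSubgroup j).subtype).comp coreToOuter =
      core true := by
  ext j
  simp [coprodToPushout, coreToOuter, core, outer]

theorem outerRetract_coreToOuter (x : Core) :
    (outerRetract (coreToOuter x) : Piece true false) ∈
      Subgroup.zpowers (outerGen true false) := by
  induction x using CoprodI.induction_on with
  | one => simp [one_mem]
  | of j n =>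
    cases j
    · exact ⟨n.toAdd, by simp [outerRetract, coreToOuter]⟩
    · simp [outerRetract, coreToOuter, one_mem]
  | mul x y hx hy => simpa using mul_mem hx hy

/-- The free product of the groups `outerSubgroup` embeds in the half and contains the core as `⟨a⟩
* ⟨c⟩`. Retracting onto the first factor fixes `g` and sends the core into `⟨a⟩`. -/
theorem mem_zpowers_of_mem_core {g : Piece true false} (hg : g ∈ outerSubgroup false)
    (h : PushoutI.of (φ := inner true) false g ∈ (core true).range) :
    g ∈ Subgroup.zpowers (outerGen true false) := by
  obtain ⟨x, hx⟩ := h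
  have h1 : coreToOuter x = CoprodI.of (i := false) (⟨g, hg⟩ : outerSubgroup false) := by
    apply coprodToPushout_injective (inner_injective true) eq_one_of_mem_outerSubgroup
    rw [← MonoidHom.comp_apply, coprodToPushout_comp_coreToOuter, hx]
    simp [coprodToPushout]
  have h2 := outerRetract_coreToOuter x
  rw [h1] at h2
  simpa [outerRetract] using h2

/-- The action modulo 127 cannot see these elements, since `a` acts trivially there. They do have
exponent sum 0 in `d`, so membership in the core would make them powers of `a`. -/
theorem conj_notMem_core {e : ℤ} (he : e = 1 ∨ e = -1) {i : ℤ} (hi : i ≠ 0) (hi' : |i| ≤ 2) :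
    halfMark true .d ^ e * halfMark true .a ^ i * halfMark true .d ^ (-e) ∉ (core true).range := by
  intro h
  have h1 : halfMark true .d ^ e * halfMark true .a ^ i * halfMark true .d ^ (-e) =
      PushoutI.of false (innerGen true false ^ e * outerGen true false ^ i *
        innerGen true false ^ (-e)) := by
    simp only [map_mul, map_zpow]; rfl
  rw [h1] at h
  obtain ⟨m, hm⟩ := mem_zpowers_of_mem_core (by
    change BS.expX 4 (BS.x 4 ^ e * BS.y 4 ^ i * BS.x 4 ^ (-e)) = 1
    simp [BS.expX]) h
  exact BS.conj_zpow_ne_zpow he hi hi' m hm.symm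

theorem Signed.exists_val_eq_zpow {G : Type*} [Group G] (f : Letter → G) (s : Signed) :
    ∃ e : ℤ, (e = 1 ∨ e = -1) ∧ s.val f = f s.1 ^ e ∧ s.inv.val f = f s.1 ^ (-e) := by
  obtain ⟨l, _ | _⟩ := s
  · exact ⟨-1, by simp, by simp [Signed.val], by simp [Signed.val, Signed.inv]⟩
  · exact ⟨1, by simp, by simp [Signed.val], by simp [Signed.val, Signed.inv]⟩

theorem conj_val_notMem_core {s t : Signed} (hs : s.1 = .d) (ht : t.1 = .a) :
    s.val (halfMark true) * t.val (halfMark true) * s.inv.val (halfMark true) ∉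
      (core true).range := by
  obtain ⟨e, he, h1, h2⟩ := s.exists_val_eq_zpow (halfMark true)
  obtain ⟨i, hi, h3, -⟩ := t.exists_val_eq_zpow (halfMark true)
  rw [h1, h2, h3, hs, ht]
  refine conj_notMem_core he ?_ ?_ <;> rcases hi with rfl | rfl <;> simp

theorem conj_val_val_notMem_core {s t : Signed} (hs : s.1 = .d) (ht : t.1 = .a) :
    s.val (halfMark true) * (t.val (halfMark true) * (t.val (halfMark true) *
      s.inv.val (halfMark true))) ∉ (core true).range := by
  obtain ⟨e, he, h1, h2⟩ := s.exists_val_eq_zpow (halfMark true)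
  obtain ⟨i, hi, h3, -⟩ := t.exists_val_eq_zpow (halfMark true)
  rw [h1, h2, h3, hs, ht, ← mul_assoc (_ ^ i), ← zpow_add, ← mul_assoc]
  refine conj_notMem_core he ?_ ?_ <;> rcases hi with rfl | rfl <;> simp

theorem val_mem_core (i : Bool) {s : Signed} (hs : s.1 = .a ∨ s.1 = .c) :
    s.val (halfMark i) ∈ (core i).range := by
  have ha : halfMark i .a ∈ (core i).range := ⟨_, core_of i false⟩
  have hc : halfMark i .c ∈ (core i).range := ⟨_, core_of i true⟩
  obtain ⟨l, _ | _⟩ := s <;> rcases hs with h | h <;> subst h <;> simp [Signed.val, ha, hc]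

-- The exceptions are conjugates of `a^±1` by `d^±1` with one outer letter before or after, and
-- conjugates of `a^±2`.
set_option synthInstance.maxHeartbeats 400000 in
set_option synthInstance.maxSize 4000 in
theorem apply_zero_ne_of_length_four : ∀ s t u v : Signed,
    Reduced s t → Reduced t u → Reduced u v →
    s.1 ≠ .b → t.1 ≠ .b → u.1 ≠ .b → v.1 ≠ .b →
    (s.1 = .d ∨ t.1 = .d ∨ u.1 = .d ∨ v.1 = .d) →
    ([s, t, u, v].map (Signed.val (halfAct true))).prod 0 ≠ 0 ∨
    (s.1 ≠ .d ∧ t.1 = .d ∧ u.1 = .a ∧ v = t.inv) ∨ (v.1 ≠ .d ∧ s.1 = .d ∧ t.1 = .a ∧ u = s.inv) ∨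
    (s.1 = .d ∧ t.1 = .a ∧ u = t ∧ v = s.inv) := by
  decide +kernel

set_option synthInstance.maxHeartbeats 400000 in
set_option synthInstance.maxSize 4000 in
theorem apply_zero_ne_of_length_three : ∀ s t u : Signed, Reduced s t → Reduced t u →
    s.1 ≠ .b → t.1 ≠ .b → u.1 ≠ .b → (s.1 = .d ∨ t.1 = .d ∨ u.1 = .d) →
    ([s, t, u].map (Signed.val (halfAct true))).prod 0 ≠ 0 ∨
    (s.1 = .d ∧ t.1 = .a ∧ u = s.inv) := by
  decide +kernel

theorem apply_zero_ne_of_length_two : ∀ s t : Signed, Reduced s t →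
    s.1 ≠ .b → t.1 ≠ .b → (s.1 = .d ∨ t.1 = .d) →
    ([s, t].map (Signed.val (halfAct true))).prod 0 ≠ 0 := by
  decide +kernel

theorem apply_zero_ne_of_length_one : ∀ s : Signed, s.1 = .d →
    ([s].map (Signed.val (halfAct true))).prod 0 ≠ 0 := by
  decide +kernel

theorem prod_notMem_core_of_d {l : List Signed} (hl : l.length ≤ 4) (hR : l.IsChain Reduced)
    (hb : ∀ s ∈ l, s.1 ≠ .b) (hd : ∃ s ∈ l, s.1 = .d) :
    (l.map (Signed.val (halfMark true))).prod ∉ (core true).range := by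
  have outer {s : Signed} (h1 : s.1 ≠ .b) (h2 : s.1 ≠ .d) :
      s.val (halfMark true) ∈ (core true).range :=
    val_mem_core true (by
      obtain ⟨l, _⟩ := s
      cases l <;> simp at h1 h2 ⊢)
  match l, hl with
  | [], _ => simp at hd
  | [s], _ =>
    exact prod_notMem_core_of_apply_zero_ne _ _ (apply_zero_ne_of_length_one s (by simpa using hd))
  | [s, t], _ =>
    simp only [List.isChain_cons_cons, List.mem_cons, List.not_mem_nil, or_false,
      forall_eq_or_imp, exists_eq_or_imp, forall_eq, exists_eq_left] at hR hb hd
    exact prod_notMem_core_of_apply_zero_ne _ _ (apply_zero_ne_of_length_two s t hR.1 hb.1 hb.2 hd)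
  | [s, t, u], _ =>
    simp only [List.isChain_cons_cons, List.mem_cons, List.not_mem_nil, or_false,
      forall_eq_or_imp, exists_eq_or_imp, forall_eq, exists_eq_left] at hR hb hd
    rcases apply_zero_ne_of_length_three s t u hR.1 hR.2.1 hb.1 hb.2.1 hb.2.2 hd with h | h
    · exact prod_notMem_core_of_apply_zero_ne _ _ h
    · obtain ⟨h1, h2, rfl⟩ := h
      simpa [mul_assoc] using conj_val_notMem_core h1 h2
  | [s, t, u, v], _ =>
    simp only [List.isChain_cons_cons, List.mem_cons, List.not_mem_nil, or_false,
      forall_eq_or_imp, exists_eq_or_imp, forall_eq, exists_eq_left] at hR hb hd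
    rcases apply_zero_ne_of_length_four s t u v hR.1 hR.2.1 hR.2.2.1 hb.1 hb.2.1 hb.2.2.1 hb.2.2.2
      hd with h | h | h | h
    · exact prod_notMem_core_of_apply_zero_ne _ _ h
    · obtain ⟨h0, h1, h2, rfl⟩ := h
      have := conj_val_notMem_core h1 h2
      simpa [Subgroup.mul_mem_cancel_left _ (outer hb.1 h0), mul_assoc] using this
    · obtain ⟨h0, h1, h2, rfl⟩ := h
      have := conj_val_notMem_core h1 h2
      simpa [← mul_assoc, Subgroup.mul_mem_cancel_right _ (outer hb.2.2.2 h0)] using this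
    · obtain ⟨h1, h2, rfl, rfl⟩ := h
      simpa using conj_val_val_notMem_core h1 h2

set_option synthInstance.maxHeartbeats 400000 in
theorem apply_zero_ne_of_b : (∀ s : Signed, s.1 = .b →
      ([s].map (Signed.val (halfAct false))).prod 0 ≠ 0) ∧
    ∀ s t : Signed, Reduced s t → s.1 ≠ .d → t.1 ≠ .d → (s.1 = .b ∨ t.1 = .b) →
      ([s, t].map (Signed.val (halfAct false))).prod 0 ≠ 0 := by
  decide +kernel

theorem prod_notMem_core_of_b {l : List Signed} (hl : l.length ≤ 2) (hR : l.IsChain Reduced)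
    (hd : ∀ s ∈ l, s.1 ≠ .d) (hb : ∃ s ∈ l, s.1 = .b) :
    (l.map (Signed.val (halfMark false))).prod ∉ (core false).range := by
  apply prod_notMem_core_of_apply_zero_ne
  match l, hl with
  | [], _ => simp at hb
  | [s], _ => exact apply_zero_ne_of_b.1 s (by simpa using hb)
  | [s, t], _ =>
    simp only [List.isChain_cons_cons, List.mem_cons, List.not_mem_nil, or_false,
      forall_eq_or_imp, exists_eq_or_imp, forall_eq, exists_eq_left] at hR hb hd
    exact apply_zero_ne_of_b.2 s t hR.1 hd.1 hd.2 hb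

/-! ### Words in a half that contain `c` -/

/-- The generators in a piece; letters that do not belong to the piece are sent to `1`. -/
def pieceMark (i j : Bool) : Letter → Piece i j
  | .a => if j = false then outerGen i j else 1
  | .b => if i = false then innerGen i j else 1
  | .c => if j = true then outerGen i j else 1
  | .d => if i = true then innerGen i j else 1

/-- The letter is one of the generators of the piece. -/
def Belongs (i j : Bool) : Letter → Prop
  | .a => j = false
  | .b => i = false
  | .c => j = true
  | .d => i = true

theorem of_pieceMark {i j : Bool} {l : Letter} (h : Belongs i j l) :
    PushoutI.of (φ := inner i) j (pieceMark i j l) = halfMark i l := by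
  cases l <;> simp only [Belongs] at h <;> subst h <;> simp [pieceMark, halfMark, of_innerGen]

theorem val_congr {G : Type*} [Group G] {f g : Letter → G} {s : Signed} (h : f s.1 = g s.1) :
    s.val f = s.val g := by simp [Signed.val, h]

theorem of_prod_pieceMark {i j : Bool} {l : List Signed} (h : ∀ s ∈ l, Belongs i j s.1) :
    PushoutI.of (φ := inner i) j (l.map (Signed.val (pieceMark i j))).prod =
      (l.map (Signed.val (halfMark i))).prod := by
  rw [Signed.map_prod_val]
  exact congrArg List.prod (List.map_congr_left fun s hs => val_congr (of_pieceMark (h s hs)))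

/-- An action modulo `127` of a piece of the half generated by `a, b, c` in which the inner
generator fixes `0`. -/
def fixInner : (j : Bool) → Piece false j →* Equiv.Perm (ZMod 127)
  | false => BS.lift shift 1 (by simp)
  | true => pieceAffine false true

/-- The generators of the pieces in the actions `fixInner`. -/
def fixInnerAct : Bool → Letter → Equiv.Perm (ZMod 127)
  | false, .a => shift
  | true, .b => scale 3
  | true, .c => shift
  | _, _ => 1

theorem fixInner_comp_pieceMark (j : Bool) : fixInner j ∘ pieceMark false j = fixInnerAct j := by
  funext l
  cases j <;> cases l <;>
    simp [pieceMark, fixInner, fixInnerAct, innerGen, outerGen, pieceAffine, rootExponent]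

/-- In these actions `b` fixes 0, so an element moving 0 is not a power of `b`. -/
theorem prod_notMem_inner_of_apply_zero_ne (j : Bool) (l : List Signed)
    (h : (l.map (Signed.val (fixInnerAct j))).prod 0 ≠ 0) :
    (l.map (Signed.val (pieceMark false j))).prod ∉ (inner false j).range := by
  rintro ⟨n, hn⟩
  apply h
  rw [← fixInner_comp_pieceMark, ← Signed.map_prod_val, ← hn, inner_apply, map_zpow]
  refine Equiv.Perm.zpow_apply_eq_self_of_apply_eq_self ?_ _
  cases j <;> simp [fixInner, innerGen, pieceAffine, scale]

set_option synthInstance.maxHeartbeats 400000 in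
set_option synthInstance.maxSize 4000 in
theorem fixInner_apply_zero_ne_of_c : (∀ s : Signed, s.1 = .c →
      ([s].map (Signed.val (fixInnerAct true))).prod 0 ≠ 0) ∧
    (∀ s t : Signed, Reduced s t → s.1 = .c ∨ s.1 = .b → t.1 = .c ∨ t.1 = .b →
      (s.1 = .c ∨ t.1 = .c) → ([s, t].map (Signed.val (fixInnerAct true))).prod 0 ≠ 0) ∧
    (∀ s t u : Signed, Reduced s t → Reduced t u → s.1 = .c ∨ s.1 = .b → t.1 = .c ∨ t.1 = .b →
      u.1 = .c ∨ u.1 = .b → (s.1 = .c ∨ t.1 = .c ∨ u.1 = .c) →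
      ([s, t, u].map (Signed.val (fixInnerAct true))).prod 0 ≠ 0) ∧
    ∀ s t u v : Signed, Reduced s t → Reduced t u → Reduced u v → s.1 = .c ∨ s.1 = .b →
      t.1 = .c ∨ t.1 = .b → u.1 = .c ∨ u.1 = .b → v.1 = .c ∨ v.1 = .b →
      (s.1 = .c ∨ t.1 = .c ∨ u.1 = .c ∨ v.1 = .c) →
      ([s, t, u, v].map (Signed.val (fixInnerAct true))).prod 0 ≠ 0 := by
  decide +kernel

set_option synthInstance.maxHeartbeats 400000 in
theorem fixInner_apply_zero_ne_of_a : (∀ s : Signed, s.1 = .a →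
      ([s].map (Signed.val (fixInnerAct false))).prod 0 ≠ 0) ∧
    ∀ s t : Signed, Reduced s t → s.1 = .a ∨ s.1 = .b → t.1 = .a ∨ t.1 = .b →
      (s.1 = .a ∨ t.1 = .a) → ([s, t].map (Signed.val (fixInnerAct false))).prod 0 ≠ 0 := by
  decide +kernel

theorem prod_notMem_inner_of_c {l : List Signed} (hl : l.length ≤ 4) (hR : l.IsChain Reduced)
    (hl' : ∀ s ∈ l, s.1 = .c ∨ s.1 = .b) (hc : ∃ s ∈ l, s.1 = .c) :
    (l.map (Signed.val (pieceMark false true))).prod ∉ (inner false true).range := by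
  apply prod_notMem_inner_of_apply_zero_ne
  obtain ⟨h1, h2, h3, h4⟩ := fixInner_apply_zero_ne_of_c
  match l, hl with
  | [], _ => simp at hc
  | [s], _ => exact h1 s (by simpa using hc)
  | [s, t], _ =>
    simp only [List.isChain_cons_cons, List.mem_cons, List.not_mem_nil, or_false,
      forall_eq_or_imp, exists_eq_or_imp, forall_eq, exists_eq_left] at hR hl' hc
    exact h2 s t hR.1 hl'.1 hl'.2 hc
  | [s, t, u], _ =>
    simp only [List.isChain_cons_cons, List.mem_cons, List.not_mem_nil, or_false,
      forall_eq_or_imp, exists_eq_or_imp, forall_eq, exists_eq_left] at hR hl' hc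
    exact h3 s t u hR.1 hR.2.1 hl'.1 hl'.2.1 hl'.2.2 hc
  | [s, t, u, v], _ =>
    simp only [List.isChain_cons_cons, List.mem_cons, List.not_mem_nil, or_false,
      forall_eq_or_imp, exists_eq_or_imp, forall_eq, exists_eq_left] at hR hl' hc
    exact h4 s t u v hR.1 hR.2.1 hR.2.2.1 hl'.1 hl'.2.1 hl'.2.2.1 hl'.2.2.2 hc

theorem prod_notMem_inner_of_a {l : List Signed} (hl : l.length ≤ 2) (hR : l.IsChain Reduced)
    (hl' : ∀ s ∈ l, s.1 = .a ∨ s.1 = .b) (ha : ∃ s ∈ l, s.1 = .a) :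
    (l.map (Signed.val (pieceMark false false))).prod ∉ (inner false false).range := by
  apply prod_notMem_inner_of_apply_zero_ne
  obtain ⟨h1, h2⟩ := fixInner_apply_zero_ne_of_a
  match l, hl with
  | [], _ => simp at ha
  | [s], _ => exact h1 s (by simpa using ha)
  | [s, t], _ =>
    simp only [List.isChain_cons_cons, List.mem_cons, List.not_mem_nil, or_false,
      forall_eq_or_imp, exists_eq_or_imp, forall_eq, exists_eq_left] at hR hl' ha
    exact h2 s t hR.1 hl'.1 hl'.2 ha

theorem Signed.val_mem {G : Type*} [Group G] {f : Letter → G} {s : Signed} {K : Subgroup G}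
    (h : f s.1 ∈ K) : s.val f ∈ K := by
  obtain ⟨l, _ | _⟩ := s <;> simpa [Signed.val] using h

theorem Signed.eq_of_reduced {s t : Signed} (h : t.1 = s.1) (hR : Reduced s t) : t = s := by
  obtain ⟨l, e⟩ := s
  obtain ⟨l', e'⟩ := t
  subst h
  cases e <;> cases e' <;> simp [Reduced, Signed.inv] at hR ⊢

theorem Signed.eq_of_isChain_reduced {l : Letter} {s t u v w : Signed} (hs : s.1 = l)
    (ht : t.1 = l) (hu : u.1 = l) (hv : v.1 = l) (hw : w.1 = l)
    (hR : [s, t, u, v, w].IsChain Reduced) : t = s ∧ u = s ∧ v = s ∧ w = s := by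
  simp only [List.isChain_cons_cons] at hR
  obtain rfl := Signed.eq_of_reduced (ht.trans hs.symm) hR.1
  obtain rfl := Signed.eq_of_reduced (hu.trans hs.symm) hR.2.1
  obtain rfl := Signed.eq_of_reduced (hv.trans hs.symm) hR.2.2.1
  obtain rfl := Signed.eq_of_reduced (hw.trans hs.symm) hR.2.2.2.1
  simp

theorem apply_zero_ne_of_power : (∀ s : Signed, s.1 = .c →
      ([s, s, s, s, s].map (Signed.val (fixInnerAct true))).prod 0 ≠ 0) ∧
    ∀ s : Signed, s.1 = .d → ([s, s, s, s, s].map (Signed.val (halfAct true))).prod 0 ≠ 0 := by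
  decide +kernel

theorem alternating_four_ne_one_of_mem {ι H : Type*} {G : ι → Type*} [∀ i, Group (G i)] [Group H]
    {φ : ∀ i, H →* G i} (hφ : ∀ i, Function.Injective (φ i)) {i j : ι} (hij : i ≠ j) :
    ∀ p ∈ (PushoutI.of (φ := φ) i).range, ∀ q ∈ (PushoutI.of (φ := φ) i).range,
      ∀ r ∈ (PushoutI.of (φ := φ) j).range, ∀ s ∈ (PushoutI.of (φ := φ) j).range,
      p ∉ (PushoutI.base φ).range → q ∉ (PushoutI.base φ).range →
      r ∉ (PushoutI.base φ).range → s ∉ (PushoutI.base φ).range → p * r * q * s ≠ 1 := by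
  rintro _ ⟨p, rfl⟩ _ ⟨q, rfl⟩ _ ⟨r, rfl⟩ _ ⟨s, rfl⟩ hp hq hr hs
  rw [of_mem_range_base_iff hφ] at hp hq hr hs
  exact alternating_four_ne_one hφ hij hp hq hr hs

theorem base_range_le {ι H : Type*} {G : ι → Type*} [∀ i, Group (G i)] [Group H]
    (φ : ∀ i, H →* G i) (i : ι) :
    (PushoutI.base φ).range ≤ (PushoutI.of (φ := φ) i).range := by
  rintro _ ⟨h, rfl⟩
  exact ⟨_, PushoutI.of_apply_eq_base φ i h⟩

theorem mem_of_eq_one {G : Type*} [Group G] {K : Subgroup G} {g : G} (h : g = 1) : g ∈ K :=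
  h ▸ K.one_mem

/-- This is the syllable argument for `⟨a, b⟩` and `⟨b, c⟩` amalgamated along `⟨b⟩`. Five reduced
letters from `{c, c⁻¹}` form a fifth power, which acts as a nonzero translation. -/
theorem halfMark_word_ne_one_of_c {s t u v w : Signed} (hs : s.1 = .c) (ht : t.1 ≠ .d)
    (hu : u.1 ≠ .d) (hv : v.1 ≠ .d) (hw : w.1 ≠ .d) (hst : Reduced s t) (htu : Reduced t u)
    (huv : Reduced u v) (hvw : Reduced v w) (hws : Reduced w s) :
    s.val (halfMark false) * t.val (halfMark false) * u.val (halfMark false) *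
      v.val (halfMark false) * w.val (halfMark false) ≠ 1 := by
  have type {s : Signed} (h : s.1 ≠ .d) : s.1 = .a ∨ s.1 = .c ∨ s.1 = .b := by
    obtain ⟨l, _⟩ := s
    cases l <;> simp at h ⊢
  refine five_letters_ne_one (val := Signed.val (halfMark false)) (R := Reduced)
    (isX := fun s => s.1 = .a) (isY := fun s => s.1 = .c)
    (isF := fun s => s.1 = .b) (base_range_le _ false) (base_range_le _ true)
    (PushoutI.inf_of_range_eq_base_range (inner_injective false) (by decide)).le
    (alternating_four_ne_one_of_mem (inner_injective false) (by decide))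
    (fun s hs => Signed.val_mem ?_) (fun s hs => Signed.val_mem ?_) (fun s hs => Signed.val_mem ?_)
    (fun l hl hR hl' hc => ?_) (fun l hl hR hl' hc => ?_)
    (fun s t u v w hs ht hu hv hw hR h => ?_)
    hs (type ht) (type hu) (type hv) (type hw) hst htu huv hvw hws
  · rw [hs]; exact ⟨_, rfl⟩
  · rw [hs]; exact ⟨_, rfl⟩
  · rw [hs]; exact ⟨_, (of_innerGen false false).symm⟩
  · rw [← of_prod_pieceMark (j := true) fun s hs => by rcases hl' s hs with h | h <;> rw [h] <;> rfl,
      of_mem_range_base_iff (inner_injective false)]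
    exact prod_notMem_inner_of_c hl hR hl' hc
  · rw [← of_prod_pieceMark (j := false) fun s hs => by rcases hl' s hs with h | h <;> rw [h] <;> rfl,
      of_mem_range_base_iff (inner_injective false)]
    exact prod_notMem_inner_of_a hl hR hl' hc
  · obtain ⟨rfl, rfl, rfl, rfl⟩ := Signed.eq_of_isChain_reduced hs ht hu hv hw hR
    apply prod_notMem_inner_of_apply_zero_ne _ _ (apply_zero_ne_of_power.1 _ hs)
    refine mem_of_eq_one ?_
    apply PushoutI.of_injective (inner_injective false) true
    rw [of_prod_pieceMark (by simp [hs, Belongs]), map_one]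
    simpa [mul_assoc] using h

/-! ### Words in the tower -/

/-- The generators in the tower. -/
def towerMark : Letter → Tower
  | .a => PushoutI.of false (halfMark false .a)
  | .b => PushoutI.of false (halfMark false .b)
  | .c => PushoutI.of false (halfMark false .c)
  | .d => PushoutI.of true (halfMark true .d)

theorem of_halfMark_a (i : Bool) : PushoutI.of (φ := core) i (halfMark i .a) =
    PushoutI.base core (CoprodI.of (i := false) (.ofAdd 1)) := by
  rw [← PushoutI.of_apply_eq_base core i, core_of]; rfl

theorem of_halfMark_c (i : Bool) : PushoutI.of (φ := core) i (halfMark i .c) =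
    PushoutI.base core (CoprodI.of (i := true) (.ofAdd 1)) := by
  rw [← PushoutI.of_apply_eq_base core i, core_of]; rfl

theorem of_halfMark {i : Bool} {l : Letter} (h : l ≠ if i then .b else .d) :
    PushoutI.of (φ := core) i (halfMark i l) = towerMark l := by
  cases l with
  | a => rw [of_halfMark_a, towerMark, of_halfMark_a]
  | b => cases i <;> simp at h; rfl
  | c => rw [of_halfMark_c, towerMark, of_halfMark_c]
  | d => cases i <;> simp at h; rfl

theorem of_prod_halfMark {i : Bool} {l : List Signed}
    (h : ∀ s ∈ l, s.1 ≠ if i then .b else .d) :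
    PushoutI.of (φ := core) i (l.map (Signed.val (halfMark i))).prod =
      (l.map (Signed.val towerMark)).prod := by
  refine (Signed.map_prod_val (G := Half i) (H := Tower) (PushoutI.of i) (halfMark i) l).trans ?_
  exact congrArg List.prod (List.map_congr_left fun s hs => val_congr (of_halfMark (h s hs)))

/-- This is the syllable argument for the two halves amalgamated along the core, with `b` and `d` as
the letters outside the core. -/
theorem towerMark_word_ne_one_of_d {s t u v w : Signed} (hs : s.1 = .d) (hst : Reduced s t)
    (htu : Reduced t u) (huv : Reduced u v) (hvw : Reduced v w) (hws : Reduced w s) :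
    s.val towerMark * t.val towerMark * u.val towerMark * v.val towerMark * w.val towerMark ≠ 1 := by
  have type (s : Signed) : s.1 = .b ∨ s.1 = .d ∨ s.1 = .a ∨ s.1 = .c := by
    obtain ⟨l, _⟩ := s
    cases l <;> simp
  refine five_letters_ne_one (val := Signed.val towerMark) (R := Reduced)
    (isX := fun s => s.1 = .b) (isY := fun s => s.1 = .d)
    (isF := fun s => s.1 = .a ∨ s.1 = .c) (base_range_le _ false) (base_range_le _ true)
    (PushoutI.inf_of_range_eq_base_range core_injective (by decide)).le
    (alternating_four_ne_one_of_mem core_injective (by decide))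
    (fun s hs => Signed.val_mem ?_) (fun s hs => Signed.val_mem ?_) (fun s hs => Signed.val_mem ?_)
    (fun l hl hR hl' hc => ?_) (fun l hl hR hl' hc => ?_)
    (fun s t u v w hs ht hu hv hw hR h => ?_)
    hs (type t) (type u) (type v) (type w) hst htu huv hvw hws
  · rw [hs]; exact ⟨_, rfl⟩
  · rw [hs]; exact ⟨_, rfl⟩
  · rcases hs with hs | hs <;> rw [hs]
    · exact ⟨_, (of_halfMark_a false).symm⟩
    · exact ⟨_, (of_halfMark_c false).symm⟩
  · have hb : ∀ s ∈ l, s.1 ≠ .b := fun s hs => by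
      rcases hl' s hs with h | h | h <;> rw [h] <;> decide
    rw [← of_prod_halfMark (i := true) hb, of_mem_range_base_iff core_injective]
    exact prod_notMem_core_of_d hl hR hb hc
  · have hd : ∀ s ∈ l, s.1 ≠ .d := fun s hs => by
      rcases hl' s hs with h | h | h <;> rw [h] <;> decide
    rw [← of_prod_halfMark (i := false) hd, of_mem_range_base_iff core_injective]
    exact prod_notMem_core_of_b hl hR hd hc
  · obtain ⟨rfl, rfl, rfl, rfl⟩ := Signed.eq_of_isChain_reduced hs ht hu hv hw hR
    apply prod_notMem_core_of_apply_zero_ne _ _ (apply_zero_ne_of_power.2 _ hs)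
    refine mem_of_eq_one ?_
    apply PushoutI.of_injective core_injective true
    rw [of_prod_halfMark (by simp [hs]), map_one]
    simpa [mul_assoc] using h

/-! ### Words in the group of Higman type -/

theorem Piece.rel {i j : Bool} {G : Type*} [Group G] (g : Piece i j →* G) :
    (g (BS.x _) ^ exponent i j)⁻¹ * g (BS.y _) * g (BS.x _) ^ exponent i j = g (BS.y _) ^ 2 := by
  rw [← map_pow, ← map_pow, ← map_inv, ← map_mul, ← map_mul, BS.rel]

/-- The homomorphism from a piece to the tower. -/
def pieceToTower (i j : Bool) : Piece i j →* Tower :=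
  (PushoutI.of (φ := core) i).comp (PushoutI.of (φ := inner i) j)

theorem pieceToTower_pieceMark {i j : Bool} {l : Letter} (h : Belongs i j l) :
    pieceToTower i j (pieceMark i j l) = towerMark l := by
  rw [pieceToTower, MonoidHom.comp_apply, of_pieceMark h, of_halfMark]
  cases l <;> cases i <;> simp [Belongs] at h ⊢

/-- The homomorphism from the group of Higman type to the tower. -/
def toTower : Group' →* Tower :=
  PresentedGroup.toGroup (f := towerMark) (by
    have h1 := Piece.rel (G := Tower) (pieceToTower false false)
    have h2 := Piece.rel (G := Tower) (pieceToTower false true)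
    have h3 := Piece.rel (G := Tower) (pieceToTower true true)
    have h4 := Piece.rel (G := Tower) (pieceToTower true false)
    have a1 := pieceToTower_pieceMark (i := false) (j := false) (l := .a) rfl
    have b1 := pieceToTower_pieceMark (i := false) (j := false) (l := .b) rfl
    have b2 := pieceToTower_pieceMark (i := false) (j := true) (l := .b) rfl
    have c2 := pieceToTower_pieceMark (i := false) (j := true) (l := .c) rfl
    have c3 := pieceToTower_pieceMark (i := true) (j := true) (l := .c) rfl
    have d3 := pieceToTower_pieceMark (i := true) (j := true) (l := .d) rfl
    have d4 := pieceToTower_pieceMark (i := true) (j := false) (l := .d) rfl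
    have a4 := pieceToTower_pieceMark (i := true) (j := false) (l := .a) rfl
    simp only [pieceMark, innerGen, outerGen, if_true, if_false, reduceCtorEq] at *
    rw [a1, b1] at h1
    rw [b2, c2] at h2
    rw [c3, d3] at h3
    rw [d4, a4] at h4
    simp only [exponent, pow_one] at h1 h2 h3 h4
    rintro r (rfl | rfl | rfl | rfl) <;>
      simp only [map_mul, map_inv, map_pow, FreeGroup.lift_apply_of, mul_inv_eq_one] <;> assumption)

/-- The generators of the group of Higman type. -/
def gen : Letter → Group' := PresentedGroup.of

theorem toTower_comp_gen : toTower ∘ gen = towerMark := by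
  funext l
  exact PresentedGroup.toGroup.of _

theorem prod_towerMark_eq_one {l : List Signed} (h : (l.map (Signed.val gen)).prod = 1) :
    (l.map (Signed.val towerMark)).prod = 1 := by
  rw [← toTower_comp_gen, ← Signed.map_prod_val, h, map_one]

/-- The half embeds in the tower, so a relation of the whole group among its letters already holds
in the half and can be tested by the actions of the half. -/
theorem prod_halfMark_eq_one {i : Bool} {l : List Signed}
    (hl : ∀ s ∈ l, s.1 ≠ if i then .b else .d) (h : (l.map (Signed.val gen)).prod = 1) :
    (l.map (Signed.val (halfMark i))).prod = 1 := by
  apply PushoutI.of_injective core_injective i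
  rw [of_prod_halfMark hl, map_one, prod_towerMark_eq_one h]

theorem prod_halfAct_eq_one {i : Bool} {l : List Signed}
    (hl : ∀ s ∈ l, s.1 ≠ if i then .b else .d) (h : (l.map (Signed.val gen)).prod = 1) :
    (l.map (Signed.val (halfAct i))).prod = 1 := by
  rw [← halfAffine_comp_halfMark, ← Signed.map_prod_val, prod_halfMark_eq_one hl h, map_one]

/-- The affine action modulo `127` of the generators of a piece. -/
def pieceAct (i j : Bool) : Letter → Equiv.Perm (ZMod 127)
  | .a => if j = false then if i = j then scale (rootExponent i j) else shift else 1
  | .b => if i = false then if i = j then shift else scale (rootExponent i j) else 1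
  | .c => if j = true then if i = j then scale (rootExponent i j) else shift else 1
  | .d => if i = true then if i = j then shift else scale (rootExponent i j) else 1

theorem pieceAffine_comp_pieceMark (i j : Bool) :
    pieceAffine i j ∘ pieceMark i j = pieceAct i j := by
  funext l
  cases i <;> cases j <;> cases l <;>
    simp [pieceAffine, pieceMark, pieceAct, innerGen, outerGen]

theorem prod_pieceAct_eq_one {i j : Bool} {l : List Signed} (hl : ∀ s ∈ l, Belongs i j s.1)
    (h : (l.map (Signed.val gen)).prod = 1) : (l.map (Signed.val (pieceAct i j))).prod = 1 := by
  rw [← pieceAffine_comp_pieceMark, ← Signed.map_prod_val]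
  have : (l.map (Signed.val (pieceMark i j))).prod = 1 := by
    apply PushoutI.of_injective (inner_injective i) j
    rw [of_prod_pieceMark hl, map_one]
    refine prod_halfMark_eq_one (fun s hs => ?_) h
    have := hl s hs
    obtain ⟨l, e⟩ := s
    cases l <;> cases i <;> simp [Belongs] at this ⊢
  rw [this, map_one]

theorem notMem_core_of_d {l : List Signed} (hl : l.length ≤ 4) (hR : l.IsChain Reduced)
    (hb : ∀ s ∈ l, s.1 ≠ .b) (hd : ∃ s ∈ l, s.1 = .d) :
    (l.map (Signed.val towerMark)).prod ∉ (PushoutI.base core).range := by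
  rw [← of_prod_halfMark (i := true) hb, of_mem_range_base_iff core_injective]
  exact prod_notMem_core_of_d hl hR hb hd

theorem notMem_core_of_b {l : List Signed} (hl : l.length ≤ 2) (hR : l.IsChain Reduced)
    (hd : ∀ s ∈ l, s.1 ≠ .d) (hb : ∃ s ∈ l, s.1 = .b) :
    (l.map (Signed.val towerMark)).prod ∉ (PushoutI.base core).range := by
  rw [← of_prod_halfMark (i := false) hd, of_mem_range_base_iff core_injective]
  exact prod_notMem_core_of_b hl hR hd hb

theorem prod_mem_range {i : Bool} {l : List Signed} (h : ∀ s ∈ l, s.1 ≠ if i then .b else .d) :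
    (l.map (Signed.val towerMark)).prod ∈ (PushoutI.of (φ := core) i).range :=
  ⟨_, of_prod_halfMark h⟩

theorem mul_ne_one_of_mem {p q : Tower} (hp : p ∈ (PushoutI.of (φ := core) false).range)
    (hq : q ∈ (PushoutI.of (φ := core) true).range) (hq' : q ∉ (PushoutI.base core).range) :
    p * q ≠ 1 := by
  intro h
  rw [← PushoutI.inf_of_range_eq_base_range core_injective (show false ≠ true by decide)] at hq'
  refine hq' ⟨?_, hq⟩
  rw [eq_inv_of_mul_eq_one_right (α := Tower) h]
  exact Subgroup.inv_mem _ hp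

theorem ne_one_of_length_two_aux : ∀ s t : Signed, Reduced s t →
    ((s.1 ≠ .d ∧ t.1 ≠ .d) ∧ (([s, t].map (Signed.val (halfAct false))).prod 0 ≠ 0 ∨
      ([s, t].map (Signed.val (halfAct false))).prod 1 ≠ 1)) ∨
    ((s.1 ≠ .b ∧ t.1 ≠ .b) ∧ (([s, t].map (Signed.val (halfAct true))).prod 0 ≠ 0 ∨
      ([s, t].map (Signed.val (halfAct true))).prod 1 ≠ 1)) ∨
    (s.1 = .b ∧ t.1 = .d) ∨ (s.1 = .d ∧ t.1 = .b) := by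
  decide +kernel

theorem mul_rotate_eq_one {G : Type*} [Group G] {x y : G} (h : x * y = 1) : y * x = 1 := by
  rw [eq_inv_of_mul_eq_one_left h, mul_inv_cancel]

/-- This makes the eight signed letters distinct and nontrivial in the group, so each edge of the
Cayley graph has a well-defined label at each end. -/
theorem val_mul_val_ne_one {s t : Signed} (hR : Reduced s t) : s.val gen * t.val gen ≠ 1 := by
  intro h
  have h' : ([s, t].map (Signed.val gen)).prod = 1 := by simpa using h
  have bd {s t : Signed} (hs : s.1 = .b) (ht : t.1 = .d) :
      s.val towerMark * t.val towerMark ≠ 1 := by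
    have h1 := prod_mem_range (i := false) (l := [s]) (by simp [hs])
    have h2 := prod_mem_range (i := true) (l := [t]) (by simp [ht])
    have h3 := notMem_core_of_d (l := [t]) (by simp) (by simp) (by simp [ht]) (by simp [ht])
    simpa using mul_ne_one_of_mem h1 h2 h3
  have h'' : s.val towerMark * t.val towerMark = 1 := by
    simpa using prod_towerMark_eq_one h'
  rcases ne_one_of_length_two_aux s t hR with ⟨hl, h1⟩ | ⟨hl, h1⟩ | ⟨hs, ht⟩ | ⟨hs, ht⟩
  · rw [prod_halfAct_eq_one (i := false) (by simpa using hl) h'] at h1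
    simp at h1
  · rw [prod_halfAct_eq_one (i := true) (by simpa using hl) h'] at h1
    simp at h1
  · exact bd hs ht h''
  · exact bd ht hs (mul_rotate_eq_one (G := Tower) h'')

theorem Signed.inv_inv (s : Signed) : s.inv.inv = s := by simp [Signed.inv]

theorem Signed.reduced_self (s : Signed) : Reduced s s := by
  obtain ⟨l, _ | _⟩ := s <;> simp [Reduced, Signed.inv]

theorem val_gen_injective : Function.Injective (Signed.val gen) := by
  intro s t h
  by_contra hne
  apply val_mul_val_ne_one (s := s) (t := t.inv) ?_ (by rw [Signed.val_inv, h, mul_inv_cancel])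
  intro h'
  exact hne (by rw [← s.inv_inv, ← h', t.inv_inv])

theorem val_gen_ne_one (s : Signed) : s.val gen ≠ 1 := fun h =>
  val_mul_val_ne_one s.reduced_self (by rw [h, one_mul])

/-- A cyclically reduced word of length five that represents the identity. -/
structure IsPentagon (s t u v w : Signed) : Prop where
  st : Reduced s t
  tu : Reduced t u
  uv : Reduced u v
  vw : Reduced v w
  ws : Reduced w s
  prod : s.val gen * t.val gen * u.val gen * v.val gen * w.val gen = 1

namespace IsPentagon

variable {s t u v w : Signed}

theorem rotate (h : IsPentagon s t u v w) : IsPentagon t u v w s :=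
  ⟨h.tu, h.uv, h.vw, h.ws, h.st, by
    have := h.prod
    simp only [mul_assoc] at this ⊢
    simpa only [mul_assoc] using mul_rotate_eq_one this⟩

theorem ne_d (h : IsPentagon s t u v w) : s.1 ≠ .d := fun hs =>
  towerMark_word_ne_one_of_d hs h.st h.tu h.uv h.vw h.ws (by
    simpa [mul_assoc] using prod_towerMark_eq_one (l := [s, t, u, v, w])
      (by simpa [mul_assoc] using h.prod))

theorem ne_c (h : IsPentagon s t u v w) : s.1 ≠ .c := fun hs =>
  halfMark_word_ne_one_of_c hs h.rotate.ne_d h.rotate.rotate.ne_d h.rotate.rotate.rotate.ne_d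
    h.rotate.rotate.rotate.rotate.ne_d h.st h.tu h.uv h.vw h.ws (by
    simpa [mul_assoc] using prod_halfMark_eq_one (i := false) (l := [s, t, u, v, w])
      (by simp [h.ne_d, h.rotate.ne_d, h.rotate.rotate.ne_d, h.rotate.rotate.rotate.ne_d,
        h.rotate.rotate.rotate.rotate.ne_d])
      (by simpa [mul_assoc] using h.prod))

theorem eq_a_or_b (h : IsPentagon s t u v w) : s.1 = .a ∨ s.1 = .b := by
  have hc := h.ne_c
  have hd := h.ne_d
  obtain ⟨l, _⟩ := s
  cases l <;> simp at hc hd ⊢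

set_option synthInstance.maxHeartbeats 400000 in
set_option synthInstance.maxSize 4000 in
theorem ne_one_of_aa : ∀ s : Signed, s.1 = .a → ∀ t : Signed, t.1 = .a → Reduced s t →
    ∀ u : Signed, u.1 = .a ∨ u.1 = .b → Reduced t u →
    ∀ v : Signed, v.1 = .a ∨ v.1 = .b → Reduced u v →
    ∀ w : Signed, w.1 = .a ∨ w.1 = .b → Reduced v w → Reduced w s →
    ([s, t, u, v, w].map (Signed.val (pieceAct false false))).prod 0 ≠ 0 ∨
      ([s, t, u, v, w].map (Signed.val (pieceAct false false))).prod 1 ≠ 1 := by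
  decide +kernel

theorem eq_b_of_eq_a (h : IsPentagon s t u v w) (hs : s.1 = .a) : t.1 = .b := by
  refine h.rotate.eq_a_or_b.resolve_left fun ht => ?_
  have h1 := ne_one_of_aa s hs t ht h.st u h.rotate.rotate.eq_a_or_b h.tu v
    h.rotate.rotate.rotate.eq_a_or_b h.uv w h.rotate.rotate.rotate.rotate.eq_a_or_b h.vw h.ws
  have hB {s : Signed} (hs : s.1 = .a ∨ s.1 = .b) : Belongs false false s.1 := by
    rcases hs with hs | hs <;> rw [hs] <;> rfl
  rw [prod_pieceAct_eq_one (i := false) (j := false) (by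
    simp only [List.mem_cons, List.not_mem_nil, or_false, forall_eq_or_imp, forall_eq]
    exact ⟨hB h.eq_a_or_b, hB h.rotate.eq_a_or_b, hB h.rotate.rotate.eq_a_or_b,
      hB h.rotate.rotate.rotate.eq_a_or_b, hB h.rotate.rotate.rotate.rotate.eq_a_or_b⟩)
    (by simpa [mul_assoc] using h.prod)] at h1
  simp at h1

end IsPentagon

/-- The two letters `x` and `y` of a piece `⟨x, y | x⁻ᵏ y xᵏ = y²⟩`. -/
def pieceLetters : Bool → Bool → Letter × Letter
  | false, false => (.a, .b)
  | false, true => (.b, .c)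
  | true, true => (.c, .d)
  | true, false => (.d, .a)

/-- The word that has the same letters as the relator of a piece, with the given signs. -/
def relatorWord (i j e f g h : Bool) : List Signed :=
  List.replicate (exponent i j) ((pieceLetters i j).1, e) ++ ((pieceLetters i j).2, f) ::
    (List.replicate (exponent i j) ((pieceLetters i j).1, g) ++
      [((pieceLetters i j).2, h), ((pieceLetters i j).2, h)])

/-- With `x` of leading sign `true`, the word either has a nontrivial scaling factor or is a
translation by `±1/2 ± 2`, which is nonzero modulo 127. -/
theorem relatorWord_apply_ne : ∀ i j f g h : Bool,
    ((relatorWord i j true f g h).map (Signed.val (pieceAct i j))).prod 0 ≠ 0 ∨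
    ((relatorWord i j true f g h).map (Signed.val (pieceAct i j))).prod 1 ≠ 1 := by
  decide +kernel

theorem eq_false_of_relatorWord_eq_one {i j e f g h : Bool}
    (hw : ((relatorWord i j e f g h).map (Signed.val gen)).prod = 1) : e = false := by
  cases e
  · rfl
  have h1 := relatorWord_apply_ne i j f g h
  rw [prod_pieceAct_eq_one (i := i) (j := j) ?_ hw] at h1
  · simp at h1
  intro s hs
  cases i <;> cases j <;> simp [relatorWord, pieceLetters, exponent] at hs <;>
    rcases hs with rfl | rfl | rfl | rfl <;> rfl

/-- The squares of `b^±1` lie outside the core, and so do `s` and `t u` as soon as they contain `d`.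
Any `d` thus leaves four alternating syllables, or two after a rotation. -/
theorem eq_c_of_prod_eq_one {e f : Bool} {s t u : Signed} (hs : s.1 = .c ∨ s.1 = .d)
    (ht : t.1 = .c ∨ t.1 = .d) (hu : u.1 = .c ∨ u.1 = .d) (htu : Reduced t u)
    (h : ([(.b, e), (.b, e), s, (.b, f), (.b, f), t, u].map (Signed.val gen)).prod = 1) :
    s.1 = .c ∧ t.1 = .c ∧ u.1 = .c := by
  replace h := prod_towerMark_eq_one h
  have hb (e : Bool) : ([(.b, e), (.b, e)].map (Signed.val towerMark)).prod ∉
      (PushoutI.base core).range :=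
    notMem_core_of_b (by simp) (by simp [Reduced, Signed.inv]) (by simp) (by simp)
  have hbX (e : Bool) : ([(.b, e), (.b, e)].map (Signed.val towerMark)).prod ∈
      (PushoutI.of (φ := core) false).range := prod_mem_range (by simp)
  have cd {s : Signed} (hs : s.1 = .c ∨ s.1 = .d) : s.1 ≠ .b := by
    rcases hs with hs | hs <;> rw [hs] <;> decide
  have hY := prod_mem_range (i := true) (l := [t, u]) (by simp [cd ht, cd hu])
  have hY' (h : t.1 = .d ∨ u.1 = .d) := notMem_core_of_d (l := [t, u]) (by simp) (by simpa)
    (by simp [cd ht, cd hu]) (by simpa)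
  rcases hs with hs | hs
  · refine ⟨hs, ?_⟩
    by_contra hc
    have hd : t.1 = .d ∨ u.1 = .d := by tauto
    have hX := prod_mem_range (i := false) (l := [(.b, e), (.b, e), s, (.b, f), (.b, f)])
      (by simp [hs])
    exact mul_ne_one_of_mem hX hY (hY' hd) (by simpa [mul_assoc] using h)
  · exfalso
    have hs1 := prod_mem_range (i := true) (l := [s]) (by simp [hs])
    have hs2 := notMem_core_of_d (l := [s]) (by simp) (by simp) (by simp [hs]) (by simp [hs])
    by_cases hd : t.1 = .d ∨ u.1 = .d
    · exact alternating_four_ne_one_of_mem core_injective (show false ≠ true by decide) _ (hbX e) _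
        (hbX f) _ hs1 _ hY (hb e) (hb f) hs2 (hY' hd) (by simpa [mul_assoc] using h)
    · have ht' : t.1 = .c := by tauto
      have hu' : u.1 = .c := by tauto
      have hX := prod_mem_range (i := false) (l := [(.b, f), (.b, f), t, u, (.b, e), (.b, e)])
        (by simp [ht', hu'])
      apply mul_ne_one_of_mem hX hs1 hs2
      have h1 := mul_rotate_eq_one (G := Tower) (x := ([(.b, e), (.b, e), s].map (Signed.val towerMark)).prod)
        (y := ([(.b, f), (.b, f), t, u].map (Signed.val towerMark)).prod)
        (by simpa [mul_assoc] using h)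
      simpa [mul_assoc] using h1

/-! ### Automorphisms of the Cayley graph -/

theorem gen_rel_ab : (gen .a)⁻¹ * gen .b * gen .a = gen .b ^ 2 :=
  PresentedGroup.mk_eq_mk_of_mul_inv_mem (rels := relators) (Or.inl rfl)

theorem gen_rel_bc : (gen .b ^ 2)⁻¹ * gen .c * gen .b ^ 2 = gen .c ^ 2 :=
  PresentedGroup.mk_eq_mk_of_mul_inv_mem (rels := relators) (Or.inr (Or.inl rfl))

theorem gen_rel_cd : (gen .c ^ 3)⁻¹ * gen .d * gen .c ^ 3 = gen .d ^ 2 :=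
  PresentedGroup.mk_eq_mk_of_mul_inv_mem (rels := relators) (Or.inr (Or.inr (Or.inl rfl)))

theorem gen_rel_da : (gen .d ^ 4)⁻¹ * gen .a * gen .d ^ 4 = gen .a ^ 2 :=
  PresentedGroup.mk_eq_mk_of_mul_inv_mem (rels := relators) (Or.inr (Or.inr (Or.inr rfl)))

theorem prod_relatorWord (i j : Bool) :
    ((relatorWord i j false true true false).map (Signed.val gen)).prod = 1 := by
  cases i <;> cases j <;> simp only [relatorWord, pieceLetters, exponent, List.map_append,
    List.map_replicate, List.map_cons, List.map_nil, List.prod_append, List.prod_replicate,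
    List.prod_cons, List.prod_nil, mul_one, Signed.val, cond_true, cond_false, inv_pow,
    ← pow_two]
  · rw [← mul_assoc, ← mul_assoc, pow_one, gen_rel_ab, mul_inv_cancel]
  · rw [← mul_assoc, ← mul_assoc, gen_rel_bc, mul_inv_cancel]
  · rw [← mul_assoc, ← mul_assoc, gen_rel_da, mul_inv_cancel]
  · rw [← mul_assoc, ← mul_assoc, gen_rel_cd, mul_inv_cancel]

theorem cayleyGraph_adj_iff {x y : Group'} :
    cayleyGraph.Adj x y ↔ ∃ s : Signed, y = x * s.val gen := by
  rw [SimpleGraph.mulCayley_adj']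
  constructor
  · rintro ⟨-, g, ⟨l, rfl | rfl⟩, rfl | rfl⟩
    · exact ⟨(l, true), rfl⟩
    · exact ⟨(l, false), (mul_inv_cancel_right y (gen l)).symm⟩
    · exact ⟨(l, false), rfl⟩
    · exact ⟨(l, true), (inv_mul_cancel_right y (gen l)).symm⟩
  · rintro ⟨s, rfl⟩
    refine ⟨fun h => val_gen_ne_one s (left_eq_mul.1 h), s.val gen, ⟨s.1, ?_⟩, Or.inl rfl⟩
    obtain ⟨l, _ | _⟩ := s
    · exact Or.inr rfl
    · exact Or.inl rfl

variable (η : cayleyGraph ≃g cayleyGraph)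

theorem exists_label (x : Group') (s : Signed) :
    ∃ t : Signed, η (x * s.val gen) = η x * t.val gen :=
  cayleyGraph_adj_iff.1 (η.map_adj_iff.2 (cayleyGraph_adj_iff.2 ⟨s, rfl⟩))

/-- The label of the image of the edge with label `s` that starts at `x`. -/
noncomputable def label (x : Group') (s : Signed) : Signed := (exists_label η x s).choose

theorem map_mul_val (x : Group') (s : Signed) :
    η (x * s.val gen) = η x * (label η x s).val gen := (exists_label η x s).choose_spec

theorem label_injective (x : Group') : Function.Injective (label η x) := by
  intro s t h
  have := map_mul_val η x s
  rw [h, ← map_mul_val] at this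
  exact val_gen_injective (mul_left_cancel (η.injective this))

theorem label_inv (x : Group') (s : Signed) :
    label η (x * s.val gen) s.inv = (label η x s).inv := by
  apply val_gen_injective
  have h := map_mul_val η (x * s.val gen) s.inv
  rw [Signed.val_inv, mul_inv_cancel_right, map_mul_val, mul_assoc, left_eq_mul] at h
  rw [Signed.val_inv, eq_inv_of_mul_eq_one_right h]

/-- Backtracking is preserved by an automorphism and by its inverse, so a reduced path has a reduced
image. -/
theorem reduced_label (x : Group') {s t : Signed} (h : Reduced s t) :
    Reduced (label η x s) (label η (x * s.val gen) t) := by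
  rw [Reduced, ← label_inv]
  exact fun h' => h (label_injective η _ h')

/-- The labels of the image of the path with labels `l` that starts at `x`. -/
noncomputable def labels : Group' → List Signed → List Signed
  | _, [] => []
  | x, s :: l => label η x s :: labels (x * s.val gen) l

theorem map_mul_prod (x : Group') (l : List Signed) :
    η (x * (l.map (Signed.val gen)).prod) =
      η x * ((labels η x l).map (Signed.val gen)).prod := by
  induction l generalizing x with
  | nil => simp [labels]
  | cons s l ih =>
    simp only [labels, List.map_cons, List.prod_cons, ← mul_assoc, ih, map_mul_val]

theorem prod_labels_eq_one (x : Group') {l : List Signed}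
    (h : (l.map (Signed.val gen)).prod = 1) :
    ((labels η x l).map (Signed.val gen)).prod = 1 := by
  have := map_mul_prod η x l
  rwa [h, mul_one, left_eq_mul] at this

theorem labels_append (x : Group') (l m : List Signed) :
    labels η x (l ++ m) =
      labels η x l ++ labels η (x * (l.map (Signed.val gen)).prod) m := by
  induction l generalizing x with
  | nil => simp [labels]
  | cons s l ih => simp [labels, ih, mul_assoc]

theorem IsPentagon.map {s t u v w : Signed} (h : IsPentagon s t u v w) (x : Group') :
    ∃ u' v' w', IsPentagon (label η x s) (label η (x * s.val gen) t) u' v' w' := by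
  have hx : x * s.val gen * t.val gen * u.val gen * v.val gen * w.val gen = x := by
    have := congrArg (x * ·) h.prod
    simpa only [← mul_assoc, mul_one] using this
  refine ⟨_, _, _, reduced_label η x h.st, reduced_label η _ h.tu, reduced_label η _ h.uv,
    reduced_label η _ h.vw, ?_, ?_⟩
  · have := reduced_label η (x * s.val gen * t.val gen * u.val gen * v.val gen) h.ws
    rwa [hx] at this
  · have := prod_labels_eq_one η x (l := [s, t, u, v, w])
      (by simpa [mul_assoc] using h.prod)
    simpa [labels, mul_assoc] using this

/-- The path that consists of the edges `p` and `q`, both starting at the same vertex, is contained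
in a pentagon. -/
def Corner (p q : Signed) : Prop := ∃ u v w, IsPentagon p.inv q u v w

theorem Corner.map {p q : Signed} (h : Corner p q) (y : Group') :
    Corner (label η y p) (label η y q) := by
  obtain ⟨u, v, w, h⟩ := h
  have := h.map η (y * p.val gen)
  rwa [label_inv, Signed.val_inv, mul_inv_cancel_right] at this

theorem Corner.eq_a_or_b {p q : Signed} (h : Corner p q) : q.1 = .a ∨ q.1 = .b := by
  obtain ⟨u, v, w, h⟩ := h
  exact h.rotate.eq_a_or_b

theorem Corner.eq_b_of_eq_a {p q : Signed} (h : Corner p q) (hq : q.1 = .a) : p.1 = .b := by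
  obtain ⟨u, v, w, h⟩ := h
  refine h.eq_a_or_b.resolve_left fun hp => ?_
  have := h.eq_b_of_eq_a hp
  rw [hq] at this
  cases this

theorem isPentagon_relator (e : Bool) :
    IsPentagon (.a, false) (.b, e) (.a, true) (.b, !e) (.b, !e) where
  st := by simp [Reduced, Signed.inv]
  tu := by simp [Reduced, Signed.inv]
  uv := by simp [Reduced, Signed.inv]
  vw := by simp [Reduced, Signed.inv]
  ws := by simp [Reduced, Signed.inv]
  prod := by
    have h := gen_rel_ab
    cases e
    · have h' := congrArg (·⁻¹) h
      simp only [mul_inv_rev, inv_inv, ← mul_assoc] at h'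
      simp only [Signed.val, cond_true, cond_false, Bool.not_false, h']
      group
    · simp only [Signed.val, cond_true, cond_false, Bool.not_true, h]
      group

theorem corner_a_b (f e : Bool) : Corner (.a, f) (.b, e) := by
  cases f
  · have := (isPentagon_relator (!e)).rotate.rotate
    simp only [Bool.not_not] at this
    exact ⟨_, _, _, this.rotate.rotate.rotate.rotate.rotate⟩
  · exact ⟨_, _, _, isPentagon_relator e⟩

theorem corner_b_b (e : Bool) : Corner (.b, !e) (.b, e) := by
  have := (isPentagon_relator (!e)).rotate.rotate.rotate
  simp only [Bool.not_not] at this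
  exact ⟨_, _, _, by simpa [Signed.inv] using this⟩

theorem corner_b_a (f : Bool) : Corner (.b, true) (.a, f) := by
  cases f
  · exact ⟨_, _, _, (isPentagon_relator true).rotate.rotate.rotate.rotate⟩
  · exact ⟨_, _, _, (isPentagon_relator false).rotate⟩

theorem not_three_of_same_letter {p q r : Signed} {l : Letter} (hp : p.1 = l) (hq : q.1 = l)
    (hr : r.1 = l) (hpq : p ≠ q) (hpr : p ≠ r) (hqr : q ≠ r) : False := by
  obtain ⟨_, e⟩ := p
  obtain ⟨_, f⟩ := q
  obtain ⟨_, g⟩ := r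
  subst hp
  obtain rfl := hq
  obtain rfl := hr
  cases e <;> cases f <;> cases g <;> simp at hpq hpr hqr

/-- An edge `b^±1` forms corners with three other edges: both `a`-edges and the opposite `b`-edge.
If its image were an `a`-edge, the images of all three would be `b`-edges, but a vertex has only two
of those. -/
theorem label_b (y : Group') (e : Bool) : (label η y (.b, e)).1 = .b := by
  refine ((corner_a_b true e).map η y).eq_a_or_b.resolve_left fun h => ?_
  exact not_three_of_same_letter (((corner_a_b true e).map η y).eq_b_of_eq_a h)
    (((corner_a_b false e).map η y).eq_b_of_eq_a h) (((corner_b_b e).map η y).eq_b_of_eq_a h)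
    ((label_injective η y).ne (by simp)) ((label_injective η y).ne (by simp))
    ((label_injective η y).ne (by simp))

/-- The image lies in a pentagon, so it has letter `a` or `b`, and both `b`-labels are already taken
by the images of the `b`-edges. -/
theorem label_a (y : Group') (f : Bool) : (label η y (.a, f)).1 = .a := by
  refine ((corner_b_a f).map η y).eq_a_or_b.resolve_right fun h => ?_
  exact not_three_of_same_letter h (label_b η y true) (label_b η y false)
    ((label_injective η y).ne (by simp)) ((label_injective η y).ne (by simp))
    ((label_injective η y).ne (by simp))

theorem label_ne_of_preserved {l : Letter} (y : Group') (hl : ∀ e, (label η y (l, e)).1 = l)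
    {s : Signed} (hs : s.1 ≠ l) : (label η y s).1 ≠ l := fun h =>
  not_three_of_same_letter h (hl true) (hl false)
    ((label_injective η y).ne fun h => hs (by rw [h]))
    ((label_injective η y).ne fun h => hs (by rw [h])) ((label_injective η y).ne (by simp))

theorem label_c_or_d (y : Group') {s : Signed} (hs : s.1 = .c ∨ s.1 = .d) :
    (label η y s).1 = .c ∨ (label η y s).1 = .d := by
  have ha := label_ne_of_preserved η y (label_a η y) (s := s) (by
    rcases hs with hs | hs <;> rw [hs] <;> decide)
  have hb := label_ne_of_preserved η y (label_b η y) (s := s) (by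
    rcases hs with hs | hs <;> rw [hs] <;> decide)
  generalize label η y s = t at ha hb
  obtain ⟨l, _⟩ := t
  cases l <;> simp at ha hb ⊢

/-- A preserved letter could only change sign along its own line, and that would be a backtrack. -/
theorem label_mul_self {l : Letter} (hl : ∀ y e, (label η y (l, e)).1 = l) (x : Group')
    (e : Bool) : label η (x * Signed.val gen (l, e)) (l, e) = label η x (l, e) :=
  Signed.eq_of_reduced ((hl _ e).trans (hl x e).symm)
    (reduced_label η x (Signed.reduced_self _))

theorem labels_replicate {l : Letter} (hl : ∀ y e, (label η y (l, e)).1 = l) (k : ℕ) (x : Group')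
    (e : Bool) : labels η x (List.replicate k (l, e)) = List.replicate k (label η x (l, e)) := by
  induction k generalizing x with
  | zero => rfl
  | succ k ih => rw [List.replicate_succ, labels, ih, label_mul_self η hl, List.replicate_succ]

/-- Signs are constant along powers, so the image of the relator is again a `relatorWord`, and
triviality forces its leading sign. The label of the opposite edge follows by injectivity. -/
theorem label_eq_of_preserved (i j : Bool)
    (hx : ∀ y e, (label η y ((pieceLetters i j).1, e)).1 = (pieceLetters i j).1)
    (hy : ∀ y e, (label η y ((pieceLetters i j).2, e)).1 = (pieceLetters i j).2)
    (y : Group') (e : Bool) :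
    label η y ((pieceLetters i j).1, e) = ((pieceLetters i j).1, e) := by
  have sgn {l : Letter} (hl : ∀ y e, (label η y (l, e)).1 = l) (y : Group') (e : Bool) :
      ∃ f, label η y (l, e) = (l, f) := ⟨(label η y (l, e)).2, Prod.ext (hl y e) rfl⟩
  have key (y : Group') : label η y ((pieceLetters i j).1, false) =
      ((pieceLetters i j).1, false) := by
    have h := prod_labels_eq_one η y (prod_relatorWord i j)
    obtain ⟨e, he⟩ := sgn hx y false
    rw [relatorWord, labels_append, labels_replicate η hx, he, labels, labels_append,
      labels_replicate η hx, labels, labels, labels, label_mul_self η hy] at h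
    obtain ⟨f, hf⟩ := sgn hy _ true
    obtain ⟨g, hg⟩ := sgn hx _ true
    obtain ⟨k, hk⟩ := sgn hy _ false
    rw [hf, hg, hk] at h
    rw [he, eq_false_of_relatorWord_eq_one h]
  cases e
  · exact key y
  · obtain ⟨f, hf⟩ := sgn hx y true
    cases f
    · rw [← key y] at hf
      simpa using label_injective η y hf
    · exact hf

theorem label_c (y : Group') (e : Bool) : (label η y (.c, e)).1 = .c := by
  have key (x : Group') : (label η x (.c, true)).1 = .c := by
    -- The base point is chosen so that after the initial `b⁻²` the path stands at `x`, where its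
    -- `c`-edge starts.
    have h := prod_labels_eq_one η (x * (Signed.val gen (.b, false) * Signed.val gen (.b, false))⁻¹)
      (prod_relatorWord false true)
    simp only [relatorWord, pieceLetters, exponent, List.replicate, List.cons_append,
      List.nil_append, labels, label_mul_self η (label_b η)] at h
    obtain ⟨e, he⟩ : ∃ e, label η (x * (Signed.val gen (.b, false) *
        Signed.val gen (.b, false))⁻¹) (.b, false) = (.b, e) := ⟨_, Prod.ext (label_b η _ _) rfl⟩
    rw [he] at h
    rw [mul_assoc _ (Signed.val gen (.b, false)), inv_mul_cancel_right] at h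
    obtain ⟨f, hf⟩ : ∃ f, label η (x * Signed.val gen (.c, true)) (.b, true) = (.b, f) :=
      ⟨_, Prod.ext (label_b η _ _) rfl⟩
    rw [hf] at h
    exact (eq_c_of_prod_eq_one (label_c_or_d η _ (.inl rfl)) (label_c_or_d η _ (.inl rfl))
      (label_c_or_d η _ (.inl rfl)) (reduced_label η _ (Signed.reduced_self _)) h).1
  cases e
  · have h := label_inv η (y * Signed.val gen (.c, false)) (.c, true)
    have h1 : y * Signed.val gen (.c, false) * Signed.val gen (.c, true) = y :=
      inv_mul_cancel_right y (gen .c)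
    rw [h1] at h
    have h2 := congrArg Prod.fst h
    exact h2.trans (key _)
  · exact key y

theorem label_d (y : Group') (e : Bool) : (label η y (.d, e)).1 = .d :=
  (label_c_or_d η y (.inr rfl)).resolve_left
    (label_ne_of_preserved η y (label_c η y) (by simp))

theorem label_eq (y : Group') (s : Signed) : label η y s = s := by
  obtain ⟨l, e⟩ := s
  cases l
  · exact label_eq_of_preserved η false false (label_a η) (label_b η) y e
  · exact label_eq_of_preserved η false true (label_b η) (label_c η) y e
  · exact label_eq_of_preserved η true true (label_c η) (label_d η) y e
  · exact label_eq_of_preserved η true false (label_d η) (label_a η) y e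

theorem map_mul_gen (x : Group') (l : Letter) : η (x * gen l) = η x * gen l := by
  have := map_mul_val η x (l, true)
  rwa [label_eq] at this

theorem map_mul_right (x g : Group') : η (x * g) = η x * g := by
  let K : Subgroup Group' :=
    { carrier := {g | ∀ x, η (x * g) = η x * g}
      one_mem' := fun x => by simp
      mul_mem' := fun {g h} hg hh x => by rw [← mul_assoc, hh, hg, mul_assoc]
      inv_mem' := fun {g} hg x => by
        have := hg (x * g⁻¹)
        rw [inv_mul_cancel_right] at this
        rw [this, mul_inv_cancel_right] }
  exact PresentedGroup.generated_by relators K (fun l x => map_mul_gen η x l) g x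

theorem vertexStabilizer_eq_bot (v : Group') : vertexStabilizer cayleyGraph v = ⊥ := by
  rw [eq_bot_iff]
  intro η hη
  have hv : η v = v := hη
  rw [Subgroup.mem_bot]
  ext x
  change η x = x
  rw [← mul_inv_cancel_left v x, map_mul_right, hv]

/-! ### Quotients of the group of Higman type -/

theorem pow_conj_eq_pow {Q : Type*} [Group Q] {x y : Q} (h : x⁻¹ * y * x = y ^ 2) (n : ℕ) :
    (x ^ n)⁻¹ * y * x ^ n = y ^ 2 ^ n := by
  induction n with
  | zero => simp
  | succ n ih =>
    have : x⁻¹ * y ^ 2 ^ n * x = (x⁻¹ * y * x) ^ 2 ^ n := by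
      simpa using (conj_pow (i := 2 ^ n) (a := x⁻¹) (b := y)).symm
    calc (x ^ (n + 1))⁻¹ * y * x ^ (n + 1) = x⁻¹ * ((x ^ n)⁻¹ * y * x ^ n) * x := by
          rw [pow_succ]; group
      _ = y ^ 2 ^ (n + 1) := by rw [ih, this, h, ← pow_mul, pow_succ']

/-- With `n` the order of `x`, conjugating `y` by `x ^ (k * n) = 1` gives `y ^ 2 ^ n = y`, so `2 ^ n
= 1` modulo `p`. The order of 2 modulo `p` exceeds 1 and divides both `n` and `p - 1`; its least
prime factor is the required `q`. -/
theorem exists_prime_lt_of_dvd_orderOf {Q : Type*} [Group Q] [Finite Q] {x y : Q} {k : ℕ}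
    (h : (x ^ k)⁻¹ * y * x ^ k = y ^ 2) {p : ℕ} (hp : p.Prime) (hpy : p ∣ orderOf y) :
    ∃ q < p, q.Prime ∧ q ∣ orderOf x := by
  have : Fact p.Prime := ⟨hp⟩
  set n := orderOf x
  have hn : 0 < n := orderOf_pos x
  have h1 : y ^ 2 ^ n = y := by
    rw [← pow_conj_eq_pow h n, ← pow_mul, mul_comm, pow_mul, pow_orderOf_eq_one]
    simp
  have h2 : orderOf y ∣ 2 ^ n - 1 := by
    apply orderOf_dvd_of_pow_eq_one
    rw [pow_sub _ Nat.one_le_two_pow, h1, pow_one, mul_inv_cancel]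
  have h3 : (2 : ZMod p) ^ n = 1 := by
    have := (ZMod.natCast_eq_zero_iff _ _).2 (hpy.trans h2)
    rw [Nat.cast_sub Nat.one_le_two_pow] at this
    simpa [sub_eq_zero] using this
  have h20 : (2 : ZMod p) ≠ 0 := fun h => by simp [h, hn.ne'] at h3
  have h21 : orderOf (2 : ZMod p) ≠ 1 := fun h => by
    rw [orderOf_eq_one_iff] at h
    exact one_ne_zero (α := ZMod p) (by linear_combination h)
  refine ⟨_, ?_, Nat.minFac_prime h21, (Nat.minFac_dvd _).trans (orderOf_dvd_of_pow_eq_one h3)⟩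
  have h4 := ZMod.orderOf_dvd_card_sub_one h20
  have h5 := Nat.le_of_dvd (Nat.sub_pos_of_lt hp.one_lt) h4
  have h6 := Nat.minFac_le (Nat.pos_of_dvd_of_pos h4 (Nat.sub_pos_of_lt hp.one_lt))
  have := hp.one_lt
  omega

theorem hom_eq_one_of_gen {G : Type*} [Group G] {f : Group' →* G} (h : ∀ l, f (gen l) = 1)
    (g : Group') : f g = 1 := by
  have : f = 1 := PresentedGroup.ext h
  rw [this, MonoidHom.one_apply]

theorem hom_rel {G : Type*} [Group G] (f : Group' →* G) :
    ((f (gen .a) ^ 1)⁻¹ * f (gen .b) * f (gen .a) ^ 1 = f (gen .b) ^ 2) ∧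
    ((f (gen .b) ^ 2)⁻¹ * f (gen .c) * f (gen .b) ^ 2 = f (gen .c) ^ 2) ∧
    ((f (gen .c) ^ 3)⁻¹ * f (gen .d) * f (gen .c) ^ 3 = f (gen .d) ^ 2) ∧
    ((f (gen .d) ^ 4)⁻¹ * f (gen .a) * f (gen .d) ^ 4 = f (gen .a) ^ 2) := by
  simp only [← map_pow, ← map_inv, ← map_mul, pow_one, gen_rel_ab, gen_rel_bc, gen_rel_cd,
    gen_rel_da, and_self]

/-- The relations link the four generators in a cycle, so a prime dividing one of the orders would
start an infinite descent of primes. -/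
theorem hom_to_finite_eq_one {Q : Type*} [Group Q] [Finite Q] (f : Group' →* Q) (g : Group') :
    f g = 1 := by
  obtain ⟨h1, h2, h3, h4⟩ := hom_rel f
  have key : ∀ p : ℕ, p.Prime → ∀ l, ¬ p ∣ orderOf (f (gen l)) := by
    intro p
    induction p using Nat.strong_induction_on with
    | _ p ih =>
      intro hp l hl
      cases l
      · obtain ⟨q, hq, hq', h⟩ := exists_prime_lt_of_dvd_orderOf h4 hp hl
        exact ih q hq hq' _ h
      · obtain ⟨q, hq, hq', h⟩ := exists_prime_lt_of_dvd_orderOf h1 hp hl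
        exact ih q hq hq' _ h
      · obtain ⟨q, hq, hq', h⟩ := exists_prime_lt_of_dvd_orderOf h2 hp hl
        exact ih q hq hq' _ h
      · obtain ⟨q, hq, hq', h⟩ := exists_prime_lt_of_dvd_orderOf h3 hp hl
        exact ih q hq hq' _ h
  refine hom_eq_one_of_gen (fun l => ?_) g
  by_contra hne
  obtain ⟨p, hp, hpl⟩ := Nat.exists_prime_and_dvd (mt orderOf_eq_one_iff.1 hne)
  exact key p hp l hpl

theorem eq_top_of_normal_of_finiteIndex (N : Subgroup Group') [N.Normal] [N.FiniteIndex] :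
    N = ⊤ := by
  rw [eq_top_iff]
  intro g _
  exact (QuotientGroup.eq_one_iff g).1 (hom_to_finite_eq_one (QuotientGroup.mk' N) g)

theorem eq_top_of_finiteIndex (N : Subgroup Group') [N.FiniteIndex] : N = ⊤ := by
  have := eq_top_of_normal_of_finiteIndex N.normalCore
  exact eq_top_iff.2 (this ▸ N.normalCore_le)

theorem hom_to_comm_eq_one {A : Type*} [CommGroup A] (f : Group' →* A) (g : Group') :
    f g = 1 := by
  obtain ⟨h1, h2, h3, h4⟩ := hom_rel f
  have key {x y : A} (h : x⁻¹ * y * x = y ^ 2) : y = 1 := by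
    rwa [mul_comm, mul_inv_cancel_left, pow_two, left_eq_mul] at h
  exact hom_eq_one_of_gen (fun l => by
    cases l
    exacts [key h4, key h1, key h2, key h3]) g

theorem eq_zero_of_map_mul {h : Group' → ℤ} (hmul : ∀ x y, h (x * y) = h x + h y) (g : Group') :
    h g = 0 := by
  let f : Group' →* Multiplicative ℤ := MonoidHom.mk' (fun x => .ofAdd (h x)) fun x y => by
    rw [hmul, ofAdd_add]
  exact Multiplicative.ofAdd.injective (hom_to_comm_eq_one f g)

/-! ### Height functions -/

theorem exists_list_prod_eq (g : Group') :
    ∃ l : List Group', (∀ s ∈ l, s ∈ generators) ∧ l.prod = g := by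
  let K : Subgroup Group' :=
    { carrier := {g | ∃ l : List Group', (∀ s ∈ l, s ∈ generators) ∧ l.prod = g}
      one_mem' := ⟨[], by simp, rfl⟩
      mul_mem' := by
        rintro _ _ ⟨l, hl, rfl⟩ ⟨m, hm, rfl⟩
        refine ⟨l ++ m, fun s hs => ?_, List.prod_append⟩
        exact (List.mem_append.1 hs).elim (hl s) (hm s)
      inv_mem' := by
        rintro _ ⟨l, hl, rfl⟩
        refine ⟨(l.map (·⁻¹)).reverse, fun s hs => ?_, (List.prod_inv_reverse l).symm⟩
        obtain ⟨t, ht, rfl⟩ := List.mem_map.1 (List.mem_reverse.1 hs)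
        obtain ⟨x, rfl | rfl⟩ := hl t ht
        · exact ⟨x, .inr rfl⟩
        · exact ⟨x, .inl (inv_inv _)⟩ }
  exact PresentedGroup.generated_by relators K
    (fun x => ⟨[gen x], fun s hs => ⟨x, .inl (List.mem_singleton.1 hs)⟩, List.prod_singleton⟩) g

theorem not_isGroupHeightFunction (h : Group' → ℤ) : ¬ IsGroupHeightFunction generators h := by
  intro hh
  obtain ⟨g, hg⟩ := hh.not_identically_zero
  refine hg (eq_zero_of_map_mul (fun x y => ?_) g)
  obtain ⟨l, hl, rfl⟩ := exists_list_prod_eq x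
  obtain ⟨m, hm, rfl⟩ := exists_list_prod_eq y
  rw [← List.prod_append, hh.map_word _ hl, hh.map_word _ hm, hh.map_word, List.map_append,
    List.sum_append]
  exact fun s hs => (List.mem_append.1 hs).elim (hl s) (hm s)

/-- The left multiplications as automorphisms of the Cayley graph. -/
def leftMul : Group' →* (cayleyGraph ≃g cayleyGraph) where
  toFun g := ⟨Equiv.mulLeft g, SimpleGraph.mulCayley_adj_mul_iff_right⟩
  map_one' := by ext x; exact one_mul x
  map_mul' g h := by ext x; exact mul_assoc g h x

theorem leftMul_apply (g x : Group') : leftMul g x = g * x := rfl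

theorem eq_leftMul (η : cayleyGraph ≃g cayleyGraph) : η = leftMul (η 1) := by
  ext x
  rw [leftMul_apply, ← map_mul_right, one_mul]

/-- By rigidity `H` consists of left multiplications, and finitely many orbits mean finitely many
cosets of the corresponding subgroup. -/
theorem leftMul_mem_of_actsQuasiTransitively {H : Subgroup (cayleyGraph ≃g cayleyGraph)}
    (hH : ActsQuasiTransitively cayleyGraph H) (g : Group') : leftMul g ∈ H := by
  obtain ⟨W, hW, hWH⟩ := hH
  let N : Subgroup Group' := H.comap leftMul
  have hfin : Finite (Group' ⧸ N) := by
    have := hW.to_subtype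
    refine Finite.of_surjective (fun w : W => (QuotientGroup.mk (w : Group')⁻¹ : Group' ⧸ N)) ?_
    intro q
    obtain ⟨g, rfl⟩ := QuotientGroup.mk_surjective q
    -- If `α` is left multiplication by `n`, then `n * g⁻¹ = w`, so `w * g = n` lies in `N` and
    -- `w⁻¹` represents the coset of `g`.
    obtain ⟨α, hα, w, hw, h⟩ := hWH g⁻¹
    refine ⟨⟨w, hw⟩, ?_⟩
    rw [QuotientGroup.eq, inv_inv]
    rw [eq_leftMul α] at hα h
    rw [leftMul_apply] at h
    change leftMul (w * g) ∈ H
    rw [← h, inv_mul_cancel_right]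
    exact hα
  have : N.FiniteIndex := Subgroup.finiteIndex_of_finite_quotient
  have : g ∈ N := eq_top_of_finiteIndex N ▸ Subgroup.mem_top g
  exact this

theorem not_isGraphHeightFunction (h : Group' → ℤ) (H : Subgroup (cayleyGraph ≃g cayleyGraph)) :
    ¬ IsGraphHeightFunction cayleyGraph 1 h H := by
  intro hh
  have hmul (x y : Group') : h (x * y) = h x + h y := by
    -- Invariance under left multiplication by `x`, applied to `y` and the origin, reads `h y - h 1
    -- = h (x * y) - h x`.
    have := hh.differenceInvariant y 1 _ (leftMul_mem_of_actsQuasiTransitively hh.quasiTransitive x)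
    rw [leftMul_apply, leftMul_apply, mul_one, hh.map_origin] at this
    linarith
  obtain ⟨u, w, -, -, h1, -⟩ := hh.exists_lt_lt 1
  rw [eq_zero_of_map_mul hmul, eq_zero_of_map_mul hmul] at h1
  exact lt_irrefl _ h1

end HigmanType

theorem mainTheorem6 :
    (¬ ∃ (h : HigmanType.Group' → ℤ)
        (H : Subgroup (HigmanType.cayleyGraph ≃g HigmanType.cayleyGraph)),
        HigmanType.IsGraphHeightFunction HigmanType.cayleyGraph 1 h H) ∧
      (¬ ∃ h : HigmanType.Group' → ℤ,
        HigmanType.IsGroupHeightFunction HigmanType.generators h) ∧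
      (∀ v : HigmanType.Group', HigmanType.vertexStabilizer HigmanType.cayleyGraph v = ⊥) ∧
      (¬ ∃ N : Subgroup HigmanType.Group', N.Normal ∧ N.FiniteIndex ∧ N ≠ ⊤) := by
  refine ⟨?_, ?_, HigmanType.vertexStabilizer_eq_bot, ?_⟩
  · rintro ⟨h, H, hh⟩
    exact HigmanType.not_isGraphHeightFunction h H hh
  · rintro ⟨h, hh⟩
    exact HigmanType.not_isGroupHeightFunction h hh
  · rintro ⟨N, hN, hfin, hne⟩
    exact hne (HigmanType.eq_top_of_normal_of_finiteIndex N)
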